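/- Let $n\ge 1$, let $R=\mathbb{C}[x_1,\dots,x_n]$ with $\deg x_i=1$, and let $D$ be an essential central reduced hyperplane arrangement in $\mathbb{C}^n$, that is, a finite set of distinct linear hyperplanes whose intersection is $\{0\}$. Let $d=\deg D$ be the number of hyperplanes and let $f\in R$ be a reduced defining polynomial of $D$, i.e. a nonzero constant times the product of one linear form $\ell_H$ with $\ker \ell_H=H$ for each hyperplane $H\in D$. Let $(\partial f)\subset R$ be the ideal generated by $\partial f/\partial x_1,\dots,\partial f/\partial x_n$, and let $M=(R/(\partial f))(-n)$ be the shifted Milnor algebra, a graded $R$-module with $M_k=(R/(\partial f))_{k-n}$. Then $M$ has a minimal graded free resolution $\cdots\to F_1\to F_0\to M\to 0$ with $F_j=\bigoplus_k R(-c_{j,k})$ of finite rank, and its Castelnuovo–Mumford regularity, defined from any such resolution, satisfies $$\operatorname{reg} M:=\max_{j,k}\,(c_{j,k}-j)\;\le\; 2d-2,$$ where $\operatorname{reg} M=-\infty$ if $M=0$. -/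

import Mathlib

open MvPolynomial

noncomputable section

namespace ArrangementRegularity

/-- The polynomial ring `R = ℂ[x₁, …, xₙ]`. -/
abbrev Poly (n : ℕ) : Type := MvPolynomial (Fin n) ℂ

/-- The graded piece `R_k`, `k ∈ ℤ`, for the grading with `deg xᵢ = 1` (so `R_k = 0` if `k < 0`). -/
def polyGrading (n : ℕ) (k : ℤ) : Submodule ℂ (Poly n) :=
  weightedHomogeneousSubmodule ℂ (fun _ : Fin n => (1 : ℤ)) k

/-- The graded maximal ideal `𝔪 = (x₁, …, xₙ)` of `R`. -/
def maxIdeal (n : ℕ) : Ideal (Poly n) :=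
  Ideal.span (Set.range (X : Fin n → Poly n))

/-- The degree `k` piece of the graded free module `⨁ᵢ R(-cᵢ)`, whose `i`-th basis vector has
degree `cᵢ`: the `i`-th coordinate has degree `k - cᵢ`. -/
def freeGrading {n r : ℕ} (c : Fin r → ℤ) (k : ℤ) : Submodule ℂ (Fin r → Poly n) :=
  Submodule.pi Set.univ (fun i => polyGrading n (k - c i))

/-- The grading of the shifted module `M(a)`: `M(a)_k = M_{a + k}`. -/
def shift {M : Type*} [AddCommGroup M] [Module ℂ M] (ℳ : ℤ → Submodule ℂ M) (a : ℤ) :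
    ℤ → Submodule ℂ M :=
  fun k => ℳ (a + k)

/-- A minimal graded free resolution `⋯ → F₁ → F₀ → M → 0` of a (finitely generated) graded
`R`-module `M` with graded pieces `ℳ k`, where `F_j = ⨁_k R(-c_{j,k})`. -/
structure MinimalGradedFreeResolution {n : ℕ} {M : Type*} [AddCommGroup M] [Module ℂ M]
    [Module (Poly n) M] (ℳ : ℤ → Submodule ℂ M) where
  /-- the rank of `F_j` -/
  rank : ℕ → ℕ
  /-- the degrees `c_{j,k}` of the basis vectors of `F_j` -/
  c : (j : ℕ) → Fin (rank j) → ℤ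
  /-- the differential `F_{j+1} → F_j` -/
  diff : (j : ℕ) → (Fin (rank (j + 1)) → Poly n) →ₗ[Poly n] (Fin (rank j) → Poly n)
  /-- the augmentation `F₀ → M` -/
  aug : (Fin (rank 0) → Poly n) →ₗ[Poly n] M
  /-- the differentials preserve degrees -/
  diff_graded : ∀ (j : ℕ) (k : ℤ), ∀ v ∈ freeGrading (n := n) (c (j + 1)) k,
    diff j v ∈ freeGrading (n := n) (c j) k
  /-- the augmentation preserves degrees -/
  aug_graded : ∀ (k : ℤ), ∀ v ∈ freeGrading (n := n) (c 0) k, aug v ∈ ℳ k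
  aug_surjective : Function.Surjective aug
  exact_zero : Function.Exact (diff 0) aug
  exact_succ : ∀ j : ℕ, Function.Exact (diff (j + 1)) (diff j)
  /-- minimality: the image of each differential lies in `𝔪 F_j` -/
  minimal : ∀ j : ℕ, LinearMap.range (diff j) ≤
    maxIdeal n • (⊤ : Submodule (Poly n) (Fin (rank j) → Poly n))

/-- The Castelnuovo-Mumford regularity `max_{j,k} (c_{j,k} - j)` read off a minimal graded free
resolution, with values in the extended reals; it is `-∞` for the zero module. -/
def MinimalGradedFreeResolution.regularity {n : ℕ} {M : Type*} [AddCommGroup M] [Module ℂ M]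
    [Module (Poly n) M] {ℳ : ℤ → Submodule ℂ M}
    (F : MinimalGradedFreeResolution (n := n) ℳ) : EReal :=
  ⨆ (j : ℕ) (k : Fin (F.rank j)), (((F.c j k - (j : ℤ) : ℤ) : ℝ) : EReal)

/-- A central reduced hyperplane arrangement in `ℂⁿ`: a finite set of (distinct) linear
hyperplanes. -/
structure CentralArrangement (n : ℕ) where
  /-- the hyperplanes -/
  hyperplanes : Finset (Submodule ℂ (Fin n → ℂ))
  isCoatom : ∀ H ∈ hyperplanes, IsCoatom H

/-- The degree of the reduced divisor `D`, i.e. the number of hyperplanes. -/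
def CentralArrangement.degree {n : ℕ} (D : CentralArrangement n) : ℕ := D.hyperplanes.card

/-- `D` is essential: its hyperplanes meet only in the origin. -/
def CentralArrangement.IsEssential {n : ℕ} (D : CentralArrangement n) : Prop :=
  ⨅ H ∈ D.hyperplanes, H = ⊥

/-- The homogeneous linear polynomial given by a linear form on `ℂⁿ`. -/
def linearPoly {n : ℕ} (φ : Module.Dual ℂ (Fin n → ℂ)) : Poly n :=
  ∑ i : Fin n, C (φ (Pi.single i 1)) * X i

/-- `f` is a (reduced) defining polynomial of `D`: up to a nonzero constant, the product of one
linear form for each hyperplane. -/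
def CentralArrangement.IsDefiningPolynomial {n : ℕ} (D : CentralArrangement n) (f : Poly n) :
    Prop :=
  ∃ (a : ℂ) (φ : Submodule ℂ (Fin n → ℂ) → Module.Dual ℂ (Fin n → ℂ)),
    a ≠ 0 ∧ (∀ H ∈ D.hyperplanes, LinearMap.ker (φ H) = H) ∧
      f = C a * ∏ H ∈ D.hyperplanes, linearPoly (φ H)

/-- The Jacobian ideal `(∂f)`, generated by the partial derivatives of `f`. -/
def jacobianIdeal {n : ℕ} (f : Poly n) : Ideal (Poly n) :=
  Ideal.span (Set.range fun i : Fin n => pderiv i f)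

/-- The Milnor algebra `R / (∂f)`. -/
abbrev MilnorAlgebra {n : ℕ} (f : Poly n) : Type := Poly n ⧸ jacobianIdeal f

/-- The grading of the Milnor algebra induced from `R`. -/
def milnorGrading {n : ℕ} (f : Poly n) (k : ℤ) : Submodule ℂ (MilnorAlgebra f) :=
  (polyGrading n k).map (Ideal.Quotient.mkₐ ℂ (jacobianIdeal f)).toLinearMap

end ArrangementRegularity

end

/-! Let f have degree d. The syzygies of the partial derivatives of f are, up to a shift, the second
syzygy module of M. Since D is reduced, a derivation killing f is logarithmic along every
hyperplane, and subtracting multiples of the Euler derivation retracts the logarithmic derivations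
onto these syzygies. The problem thus becomes a regularity bound for logarithmic derivations: in
polynomial degree it is d - rank + 1 (`logDerBound`). For essential D the rank is n; the shift by n
+ d - 1 gives 2d, and passing from the second syzygies to M subtracts 2.

The bound is proved by induction on the set of hyperplanes. If some form is independent of the
others, the module is a retract of the one for the deletion plus R(-1), and the bound does not
change (`LogDerBound.of_erase_coloop`). Otherwise all deletions have the same rank ρ as the
arrangement. Multiplication by the form of H factors through the module of the deletion of H, and
the forms span a space of dimension ρ. The approximation theorem `degree_le_of_lowNullhomotopic`
then costs only one degree.

That theorem is proved by dualizing. A basis vector of too high degree, in the last position where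
one occurs, gives a cocycle in Hom(F, R). The homotopies attached to the ρ forms, used one after the
other along a regular sequence, make it a coboundary (`isCoboundaryMod_of_cocycle`), which
minimality forbids. There are enough forms because F_j = 0 for j ≥ ρ: coordinates along the common
intersection and one more form are regular on the module (`logDer_regular`), and this limits the
length of F (`rank_eq_zero_of_regular`). Degrees in a minimal resolution are compared with those in
any other resolution by `exists_degree_le_of_retract`. -/

noncomputable section

namespace ArrangementRegularity

/-! ### Graded pieces of R and the maximal ideal. -/

section Poly

variable {n : ℕ}

theorem polyGrading_mul {a b : ℤ} {p q : Poly n} (hp : p ∈ polyGrading n a)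
    (hq : q ∈ polyGrading n b) : p * q ∈ polyGrading n (a + b) :=
  IsWeightedHomogeneous.mul hp hq

theorem C_mem_polyGrading (z : ℂ) : (C z : Poly n) ∈ polyGrading n 0 :=
  isWeightedHomogeneous_C _ z

theorem X_mem_polyGrading (i : Fin n) : (X i : Poly n) ∈ polyGrading n 1 :=
  isWeightedHomogeneous_X ℂ _ i

theorem weight_one_eq_degree (d : Fin n →₀ ℕ) :
    Finsupp.weight (fun _ : Fin n => (1 : ℤ)) d = (d.degree : ℤ) := by
  rw [Finsupp.weight_apply, Finsupp.degree_apply, Finsupp.sum]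
  simp

theorem mem_polyGrading_iff {k : ℤ} {p : Poly n} :
    p ∈ polyGrading n k ↔ ∀ d, coeff d p ≠ 0 → (d.degree : ℤ) = k := by
  simp only [← weight_one_eq_degree]
  exact Iff.rfl

theorem eq_zero_of_mem_polyGrading_neg {k : ℤ} (hk : k < 0) {p : Poly n}
    (hp : p ∈ polyGrading n k) : p = 0 := by
  ext d
  by_contra h
  have := mem_polyGrading_iff.1 hp d (by simpa using h)
  omega

theorem eq_C_of_mem_polyGrading_zero {p : Poly n} (hp : p ∈ polyGrading n 0) :
    p = C (constantCoeff p) := by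
  ext d
  rw [coeff_C]
  split_ifs with h
  · subst h; rfl
  · by_contra h'
    have := mem_polyGrading_iff.1 hp d h'
    rw [Nat.cast_eq_zero, Finsupp.degree_eq_zero_iff] at this
    exact h this.symm

theorem mem_maxIdeal_iff {p : Poly n} : p ∈ maxIdeal n ↔ constantCoeff p = 0 := by
  constructor
  · intro h
    have : maxIdeal n ≤ RingHom.ker (constantCoeff : Poly n →+* ℂ) := by
      rw [maxIdeal, Ideal.span_le]
      rintro _ ⟨i, rfl⟩
      simp [RingHom.mem_ker]
    exact this h
  · intro h
    rw [maxIdeal, ← Set.image_univ, mem_ideal_span_X_image]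
    intro d hd
    have hd0 : d ≠ 0 := by
      rintro rfl
      exact (mem_support_iff.1 hd) h
    obtain ⟨i, hi⟩ := Finsupp.ne_iff.1 hd0
    exact ⟨i, Set.mem_univ _, hi⟩

theorem one_notMem_maxIdeal : (1 : Poly n) ∉ maxIdeal n := by
  simp [mem_maxIdeal_iff]

theorem mem_maxIdeal_of_pos {k : ℤ} (hk : 0 < k) {p : Poly n} (hp : p ∈ polyGrading n k) :
    p ∈ maxIdeal n := by
  rw [mem_maxIdeal_iff]
  by_contra h
  have := mem_polyGrading_iff.1 hp 0 h
  simp at this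
  omega

theorem eq_zero_of_mem_maxIdeal_of_nonpos {k : ℤ} (hk : k ≤ 0) {p : Poly n}
    (hp : p ∈ polyGrading n k) (hm : p ∈ maxIdeal n) : p = 0 := by
  rcases hk.lt_or_eq with h | rfl
  · exact eq_zero_of_mem_polyGrading_neg h hp
  · rw [eq_C_of_mem_polyGrading_zero hp, mem_maxIdeal_iff.1 hm, C_0]

end Poly

/-! ### Gradings given by projections. -/

/-- `π k` is the projection of `M` onto its degree `k` piece. -/
structure GradedProj {M : Type*} [AddCommGroup M] [Module ℂ M] (ℳ : ℤ → Submodule ℂ M)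
    (π : ℤ → M →ₗ[ℂ] M) : Prop where
  mem : ∀ k m, π k m ∈ ℳ k
  self : ∀ k, ∀ m ∈ ℳ k, π k m = m
  ne : ∀ k l, k ≠ l → ∀ m ∈ ℳ k, π l m = 0
  exists_sum : ∀ m, ∃ s : Finset ℤ, m = ∑ k ∈ s, π k m

section GradedProj

variable {M N : Type*} [AddCommGroup M] [Module ℂ M] [AddCommGroup N] [Module ℂ N]
  {ℳ : ℤ → Submodule ℂ M} {𝒩 : ℤ → Submodule ℂ N}
  {π : ℤ → M →ₗ[ℂ] M} {ρ : ℤ → N →ₗ[ℂ] N}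

/-- Graded maps commute with the projections onto graded pieces. -/
theorem GradedProj.map_proj (hπ : GradedProj ℳ π) (hρ : GradedProj 𝒩 ρ) {a : ℤ}
    (T : M →+ N) (hT : ∀ k, ∀ m ∈ ℳ k, T m ∈ 𝒩 (k + a)) (k : ℤ) (m : M) :
    T (π k m) = ρ (k + a) (T m) := by
  obtain ⟨s, hs⟩ := hπ.exists_sum m
  have key : ∀ l, T (π k (π l m)) = ρ (k + a) (T (π l m)) := by
    intro l
    by_cases h : l = k
    · subst h
      rw [hπ.self l _ (hπ.mem l m), hρ.self _ _ (hT _ _ (hπ.mem l m))]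
    · rw [hπ.ne l k h _ (hπ.mem l m), map_zero,
        hρ.ne (l + a) (k + a) (by omega) _ (hT _ _ (hπ.mem l m))]
  rw [hs]
  simp only [map_sum]
  exact Finset.sum_congr rfl fun l _ => key l

theorem GradedProj.shift (hπ : GradedProj ℳ π) (a : ℤ) :
    GradedProj (shift ℳ a) (fun k => π (a + k)) where
  mem k m := hπ.mem _ m
  self k m hm := hπ.self _ m hm
  ne k l hkl m hm := hπ.ne _ _ (by omega) m hm
  exists_sum m := by
    obtain ⟨s, hs⟩ := hπ.exists_sum m
    refine ⟨s.image (fun k => k - a), ?_⟩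
    rw [Finset.sum_image (by intro x _ y _ h; simpa using h)]
    simpa using hs

end GradedProj

/-- A graded module over the graded ring `R`. -/
structure IsGradedModule (n : ℕ) {M : Type*} [AddCommGroup M] [Module ℂ M] [Module (Poly n) M]
    (ℳ : ℤ → Submodule ℂ M) : Prop where
  smul_mem : ∀ a b, ∀ p ∈ polyGrading n a, ∀ m ∈ ℳ b, p • m ∈ ℳ (a + b)
  exists_proj : ∃ π : ℤ → M →ₗ[ℂ] M, GradedProj ℳ π

theorem IsGradedModule.shift {n : ℕ} {M : Type*} [AddCommGroup M] [Module ℂ M]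
    [Module (Poly n) M] {ℳ : ℤ → Submodule ℂ M} (h : IsGradedModule n ℳ) (a : ℤ) :
    IsGradedModule n (shift ℳ a) where
  smul_mem b c p hp m hm := by
    have := h.smul_mem b (a + c) p hp m hm
    rwa [show b + (a + c) = a + (b + c) by ring] at this
  exists_proj := by
    obtain ⟨π, hπ⟩ := h.exists_proj
    exact ⟨_, hπ.shift a⟩

/-! ### Graded free modules and graded submodules. -/

section Free

variable {n r s : ℕ}

/-- The degree `k` component of a polynomial. -/
def polyProj (n : ℕ) (k : ℤ) : Poly n →ₗ[ℂ] Poly n :=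
  weightedHomogeneousComponent (fun _ : Fin n => (1 : ℤ)) k

theorem polyProj_gradedProj (n : ℕ) : GradedProj (polyGrading n) (polyProj n) where
  mem k p := weightedHomogeneousComponent_mem _ p k
  self k p hp := IsWeightedHomogeneous.weightedHomogeneousComponent_same hp
  ne k l hkl p hp := IsWeightedHomogeneous.weightedHomogeneousComponent_ne _ hp hkl.symm
  exists_sum p := by
    have hf := weightedHomogeneousComponent_finsupp (w := fun _ : Fin n => (1 : ℤ)) p
    refine ⟨hf.toFinset, ?_⟩
    conv_lhs => rw [← sum_weightedHomogeneousComponent (fun _ : Fin n => (1 : ℤ)) p]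
    exact finsum_eq_sum _ hf

theorem polyGrading_isGradedModule (n : ℕ) : IsGradedModule n (polyGrading n) where
  smul_mem _ _ _ hp _ hm := polyGrading_mul hp hm
  exists_proj := ⟨_, polyProj_gradedProj n⟩

/-- The degree `k` component of a vector in a graded free module. -/
def freeProj (c : Fin r → ℤ) (k : ℤ) : (Fin r → Poly n) →ₗ[ℂ] (Fin r → Poly n) :=
  LinearMap.pi fun i => polyProj n (k - c i) ∘ₗ LinearMap.proj i

theorem freeProj_apply (c : Fin r → ℤ) (k : ℤ) (v : Fin r → Poly n) (i : Fin r) :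
    freeProj c k v i = polyProj n (k - c i) (v i) := rfl

theorem mem_freeGrading {c : Fin r → ℤ} {k : ℤ} {v : Fin r → Poly n} :
    v ∈ freeGrading c k ↔ ∀ i, v i ∈ polyGrading n (k - c i) := by
  simp [freeGrading, Submodule.mem_pi]

theorem freeProj_gradedProj (c : Fin r → ℤ) :
    GradedProj (freeGrading (n := n) c) (freeProj c) where
  mem k v := mem_freeGrading.2 fun i => (polyProj_gradedProj n).mem _ _
  self k v hv := funext fun i => (polyProj_gradedProj n).self _ _ (mem_freeGrading.1 hv i)
  ne k l hkl v hv := funext fun i =>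
    (polyProj_gradedProj n).ne _ _ (by omega) _ (mem_freeGrading.1 hv i)
  exists_sum v := by
    have hf : ∀ i, Set.Finite (Function.support fun k => polyProj n (k - c i) (v i)) := by
      intro i
      have := weightedHomogeneousComponent_finsupp (w := fun _ : Fin n => (1 : ℤ)) (v i)
      refine (this.image (fun k => k + c i)).subset ?_
      intro k hk
      exact ⟨k - c i, hk, by ring⟩
    refine ⟨Finset.univ.biUnion fun i => (hf i).toFinset, ?_⟩
    ext1 i
    rw [Finset.sum_apply]
    simp only [freeProj_apply]
    rw [← finsum_eq_sum_of_support_subset]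
    · conv_lhs => rw [← sum_weightedHomogeneousComponent (fun _ : Fin n => (1 : ℤ)) (v i)]
      exact (finsum_comp_equiv (Equiv.subRight (c i))
        (f := fun k => polyProj n k (v i))).symm
    · intro k hk
      simp only [Finset.coe_biUnion, Set.mem_iUnion]
      exact ⟨i, Finset.mem_coe.2 (Finset.mem_univ i), by simpa using hk⟩

theorem freeGrading_isGradedModule (c : Fin r → ℤ) :
    IsGradedModule n (freeGrading (n := n) c) where
  smul_mem a b p hp v hv := mem_freeGrading.2 fun i => by
    have := polyGrading_mul hp (mem_freeGrading.1 hv i)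
    rwa [show a + (b - c i) = a + b - c i by ring] at this
  exists_proj := ⟨_, freeProj_gradedProj c⟩

theorem single_mem_freeGrading (c : Fin r → ℤ) (i : Fin r) {a : ℤ} {p : Poly n}
    (hp : p ∈ polyGrading n a) : Pi.single i p ∈ freeGrading c (c i + a) := by
  rw [mem_freeGrading]
  intro j
  by_cases h : j = i
  · subst h; simpa using hp
  · rw [Pi.single_eq_of_ne h]; exact zero_mem _

theorem single_one_mem_freeGrading (c : Fin r → ℤ) (i : Fin r) :
    (Pi.single i 1 : Fin r → Poly n) ∈ freeGrading c (c i) := by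
  have := single_mem_freeGrading c i (C_mem_polyGrading (n := n) 1)
  simpa using this

theorem pi_eq_sum_smul_single (v : Fin r → Poly n) :
    v = ∑ i, v i • (Pi.single i 1 : Fin r → Poly n) := by
  ext1 j
  simp [Finset.sum_apply, Pi.single_apply]

/-- A linear map out of a graded free module is graded once it is so on the basis. -/
theorem graded_of_basis {M : Type*} [AddCommGroup M] [Module ℂ M] [Module (Poly n) M]
    {ℳ : ℤ → Submodule ℂ M} (hℳ : IsGradedModule n ℳ) (c : Fin r → ℤ) (a : ℤ)
    (T : (Fin r → Poly n) →ₗ[Poly n] M) (hT : ∀ i, T (Pi.single i 1) ∈ ℳ (c i + a))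
    (k : ℤ) (v : Fin r → Poly n) (hv : v ∈ freeGrading c k) : T v ∈ ℳ (k + a) := by
  rw [pi_eq_sum_smul_single v, map_sum]
  refine Submodule.sum_mem _ fun i _ => ?_
  rw [map_smul]
  have := hℳ.smul_mem _ _ _ (mem_freeGrading.1 hv i) _ (hT i)
  rwa [show k - c i + (c i + a) = k + a by ring] at this

/-- The grading induced on a submodule. -/
def subGrading {M : Type*} [AddCommGroup M] [Module ℂ M] [Module (Poly n) M]
    [IsScalarTower ℂ (Poly n) M] (ℳ : ℤ → Submodule ℂ M) (K : Submodule (Poly n) M) (k : ℤ) :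
    Submodule ℂ K :=
  (ℳ k).comap (K.subtype.restrictScalars ℂ)

theorem mem_subGrading {M : Type*} [AddCommGroup M] [Module ℂ M] [Module (Poly n) M]
    [IsScalarTower ℂ (Poly n) M] {ℳ : ℤ → Submodule ℂ M} {K : Submodule (Poly n) M} {k : ℤ}
    {x : K} : x ∈ subGrading ℳ K k ↔ (x : M) ∈ ℳ k := Iff.rfl

theorem subGrading_isGradedModule {M : Type*} [AddCommGroup M] [Module ℂ M] [Module (Poly n) M]
    [IsScalarTower ℂ (Poly n) M] {ℳ : ℤ → Submodule ℂ M} (hℳ : IsGradedModule n ℳ)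
    {π : ℤ → M →ₗ[ℂ] M} (hπ : GradedProj ℳ π) (K : Submodule (Poly n) M)
    (hK : ∀ k, ∀ v ∈ K, π k v ∈ K) : IsGradedModule n (subGrading ℳ K) where
  smul_mem a b p hp x hx := hℳ.smul_mem a b p hp x hx
  exists_proj := by
    refine ⟨fun k => LinearMap.restrict (p := K.restrictScalars ℂ) (q := K.restrictScalars ℂ)
      (π k) (fun v hv => hK k v hv), ?_⟩
    refine ⟨fun k m => hπ.mem k m, fun k m hm => Subtype.ext (hπ.self k m hm),
      fun k l hkl m hm => Subtype.ext (hπ.ne k l hkl m hm), fun m => ?_⟩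
    obtain ⟨s, hs⟩ := hπ.exists_sum (m : M)
    refine ⟨s, Subtype.ext ?_⟩
    have : ((∑ k ∈ s, LinearMap.restrict (p := K.restrictScalars ℂ) (q := K.restrictScalars ℂ)
      (π k) (fun v hv => hK k v hv) m : K.restrictScalars ℂ) : M) = ∑ k ∈ s, π k m := by
      rw [Submodule.coe_sum]
      rfl
    exact hs.trans this.symm

/-- The kernel of a graded map is stable under projections. -/
theorem ker_stable {M N : Type*} [AddCommGroup M] [Module ℂ M] [AddCommGroup N] [Module ℂ N]
    {ℳ : ℤ → Submodule ℂ M} {𝒩 : ℤ → Submodule ℂ N} {π : ℤ → M →ₗ[ℂ] M}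
    {ρ : ℤ → N →ₗ[ℂ] N} (hπ : GradedProj ℳ π) (hρ : GradedProj 𝒩 ρ) {a : ℤ} (T : M →+ N)
    (hT : ∀ k, ∀ m ∈ ℳ k, T m ∈ 𝒩 (k + a)) (k : ℤ) (v : M) (hv : T v = 0) :
    T (π k v) = 0 := by
  rw [hπ.map_proj hρ T hT, hv, map_zero]

/-- Homogeneous preimages of homogeneous elements. -/
theorem exists_homogeneous_preimage {M N : Type*} [AddCommGroup M] [Module ℂ M]
    [AddCommGroup N] [Module ℂ N]
    {ℳ : ℤ → Submodule ℂ M} {𝒩 : ℤ → Submodule ℂ N} {π : ℤ → M →ₗ[ℂ] M}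
    {ρ : ℤ → N →ₗ[ℂ] N} (hπ : GradedProj ℳ π) (hρ : GradedProj 𝒩 ρ) {a : ℤ} (T : M →+ N)
    (hT : ∀ k, ∀ m ∈ ℳ k, T m ∈ 𝒩 (k + a)) {k : ℤ} {v : M} (hv : T v ∈ 𝒩 (k + a)) :
    ∃ u ∈ ℳ k, T u = T v :=
  ⟨π k v, hπ.mem k v, by rw [hπ.map_proj hρ T hT, hρ.self _ _ hv]⟩

end Free

/-! ### Graded resolutions and the comparison theorem. -/

/-- A graded free resolution by free modules of finite rank, not necessarily minimal. -/
structure GradedFreeResolution {n : ℕ} {M : Type*} [AddCommGroup M] [Module ℂ M]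
    [Module (Poly n) M] (ℳ : ℤ → Submodule ℂ M) where
  /-- the rank of `F_j` -/
  rank : ℕ → ℕ
  /-- the degrees of the basis vectors of `F_j` -/
  c : (j : ℕ) → Fin (rank j) → ℤ
  /-- the differential `F_{j+1} → F_j` -/
  diff : (j : ℕ) → (Fin (rank (j + 1)) → Poly n) →ₗ[Poly n] (Fin (rank j) → Poly n)
  /-- the augmentation `F₀ → M` -/
  aug : (Fin (rank 0) → Poly n) →ₗ[Poly n] M
  diff_graded : ∀ (j : ℕ) (k : ℤ), ∀ v ∈ freeGrading (n := n) (c (j + 1)) k,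
    diff j v ∈ freeGrading (n := n) (c j) k
  aug_graded : ∀ (k : ℤ), ∀ v ∈ freeGrading (n := n) (c 0) k, aug v ∈ ℳ k
  aug_surjective : Function.Surjective aug
  exact_zero : Function.Exact (diff 0) aug
  exact_succ : ∀ j : ℕ, Function.Exact (diff (j + 1)) (diff j)

/-- Forget minimality. -/
def MinimalGradedFreeResolution.toGraded {n : ℕ} {M : Type*} [AddCommGroup M] [Module ℂ M]
    [Module (Poly n) M] {ℳ : ℤ → Submodule ℂ M}
    (F : MinimalGradedFreeResolution (n := n) ℳ) : GradedFreeResolution (n := n) ℳ where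
  rank := F.rank
  c := F.c
  diff := F.diff
  aug := F.aug
  diff_graded := F.diff_graded
  aug_graded := F.aug_graded
  aug_surjective := F.aug_surjective
  exact_zero := F.exact_zero
  exact_succ := F.exact_succ

/-- `T` is homogeneous of degree `a`. -/
def IsGradedMap {n r s : ℕ} (c : Fin r → ℤ) (c' : Fin s → ℤ) (a : ℤ)
    (T : (Fin r → Poly n) →ₗ[Poly n] (Fin s → Poly n)) : Prop :=
  ∀ k, ∀ v ∈ freeGrading c k, T v ∈ freeGrading c' (k + a)

/-- Dependent choice for a family of types: chain maps and homotopies are built degree by degree,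
with `P` the invariant that allows the next choice and `Q` the relation linking consecutive ones. -/
theorem exists_dependent_seq {α : ℕ → Type*} (P : ∀ j, α j → Prop)
    (Q : ∀ j, α j → α (j + 1) → Prop) (h0 : ∃ a, P 0 a)
    (hs : ∀ j a, P j a → ∃ b, P (j + 1) b ∧ Q j a b) :
    ∃ s : ∀ j, α j, (∀ j, P j (s j)) ∧ ∀ j, Q j (s j) (s (j + 1)) := by
  choose a0 ha0 using h0
  choose f hf using hs
  let s : ∀ j, { a : α j // P j a } := fun j =>
    Nat.rec (motive := fun j => { a : α j // P j a }) ⟨a0, ha0⟩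
      (fun j x => ⟨f j x.1 x.2, (hf j x.1 x.2).1⟩) j
  exact ⟨fun j => (s j).1, fun j => (s j).2, fun j => (hf j (s j).1 (s j).2).2⟩

section Lift

variable {n r s : ℕ} {M : Type*} [AddCommGroup M] [Module ℂ M] [Module (Poly n) M]
  {ℳ : ℤ → Submodule ℂ M}

/-- Graded maps out of a graded free module lift along graded maps. -/
theorem exists_graded_lift (hℳ : IsGradedModule n ℳ) {c : Fin r → ℤ} {c' : Fin s → ℤ} {a : ℤ}
    (D : (Fin s → Poly n) →ₗ[Poly n] M) (hD : ∀ k, ∀ v ∈ freeGrading c' k, D v ∈ ℳ k)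
    (T : (Fin r → Poly n) →ₗ[Poly n] M) (hT : ∀ k, ∀ v ∈ freeGrading c k, T v ∈ ℳ (k + a))
    (hr : ∀ v, T v ∈ LinearMap.range D) :
    ∃ T' : (Fin r → Poly n) →ₗ[Poly n] (Fin s → Poly n),
      IsGradedMap c c' a T' ∧ ∀ v, D (T' v) = T v := by
  obtain ⟨π, hπ⟩ := hℳ.exists_proj
  have : ∀ i, ∃ u ∈ freeGrading (n := n) c' (c i + a), D u = T (Pi.single i 1) := by
    intro i
    obtain ⟨u, hu⟩ := hr (Pi.single i 1)
    have h1 : D u ∈ ℳ (c i + a + 0) := by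
      rw [hu, add_zero]
      exact hT _ _ (single_one_mem_freeGrading c i)
    obtain ⟨u', hu', hu''⟩ := exists_homogeneous_preimage (freeProj_gradedProj c') hπ
      (a := 0) D.toAddMonoidHom (fun k m hm => by simpa using hD k m hm) h1
    exact ⟨u', hu', hu''.trans hu⟩
  choose u hu hDu using this
  let T' := (Pi.basisFun (Poly n) (Fin r)).constr (Poly n) u
  have hT' : ∀ i, T' (Pi.single i 1) = u i := fun i => by
    have := (Pi.basisFun (Poly n) (Fin r)).constr_basis (Poly n) u i
    rwa [Pi.basisFun_apply] at this
  refine ⟨T', fun k v hv => ?_, fun v => ?_⟩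
  · exact graded_of_basis (freeGrading_isGradedModule c') c a T' (fun i => by
      rw [hT']; exact hu i) k v hv
  · have : D ∘ₗ T' = T := by
      refine (Pi.basisFun (Poly n) (Fin r)).ext fun i => ?_
      simp [hT', hDu]
    rw [← this]; rfl

end Lift

section Comparison

variable {n : ℕ} {M N : Type*} [AddCommGroup M] [Module ℂ M] [Module (Poly n) M]
  [AddCommGroup N] [Module ℂ N] [Module (Poly n) N]
  {ℳ : ℤ → Submodule ℂ M} {𝒩 : ℤ → Submodule ℂ N}

namespace GradedFreeResolution

theorem diff_diff (G : GradedFreeResolution (n := n) ℳ) (j : ℕ) (v) :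
    G.diff j (G.diff (j + 1) v) = 0 := (G.exact_succ j).apply_apply_eq_zero v

theorem aug_diff (G : GradedFreeResolution (n := n) ℳ) (v) :
    G.aug (G.diff 0 v) = 0 := G.exact_zero.apply_apply_eq_zero v

/-- The comparison theorem: graded maps lift to graded chain maps. -/
theorem exists_chainMap (F : GradedFreeResolution (n := n) ℳ) (G : GradedFreeResolution (n := n) 𝒩)
    (h𝒩 : IsGradedModule n 𝒩) {a : ℤ} (φ : M →ₗ[Poly n] N)
    (hφ : ∀ k, ∀ m ∈ ℳ k, φ m ∈ 𝒩 (k + a)) :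
    ∃ Φ : ∀ j, (Fin (F.rank j) → Poly n) →ₗ[Poly n] (Fin (G.rank j) → Poly n),
      (∀ j, IsGradedMap (F.c j) (G.c j) a (Φ j)) ∧ (∀ v, G.aug (Φ 0 v) = φ (F.aug v)) ∧
        ∀ j v, G.diff j (Φ (j + 1) v) = Φ j (F.diff j v) := by
  obtain ⟨Φ₀, h0, h0'⟩ := exists_graded_lift h𝒩 (c := F.c 0) (a := a) G.aug G.aug_graded
    (φ ∘ₗ F.aug) (fun k v hv => hφ _ _ (F.aug_graded k v hv))
    (fun v => G.aug_surjective _)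
  obtain ⟨Φ, hΦ, hΦ'⟩ := exists_dependent_seq
    (α := fun j => (Fin (F.rank j) → Poly n) →ₗ[Poly n] (Fin (G.rank j) → Poly n))
    -- The second clause is what the next lift needs. The third remembers the initial value `Φ₀`,
    -- which the dependent choice would otherwise forget.
    (fun j Φ => IsGradedMap (F.c j) (G.c j) a Φ ∧
      (∀ v, Φ (F.diff j v) ∈ LinearMap.range (G.diff j)) ∧
        ∀ h : j = 0, Φ = h ▸ Φ₀)
    (fun j Φ Φ' => ∀ v, G.diff j (Φ' v) = Φ (F.diff j v))
    ⟨Φ₀, h0, fun v => by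
      apply (G.exact_zero _).1
      rw [h0', LinearMap.comp_apply, F.aug_diff, map_zero], fun _ => rfl⟩
    (by
      rintro j Φ ⟨hg, hr, -⟩
      obtain ⟨Φ', hg', h'⟩ := exists_graded_lift (freeGrading_isGradedModule (G.c j))
        (c := F.c (j + 1)) (a := a) (G.diff j) (G.diff_graded j) (Φ ∘ₗ F.diff j)
        (fun k v hv => hg _ _ (F.diff_graded j k v hv)) hr
      refine ⟨Φ', ⟨hg', fun v => ?_, fun h => by omega⟩, h'⟩
      apply (G.exact_succ j _).1
      rw [h', LinearMap.comp_apply, F.diff_diff, map_zero])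
  refine ⟨Φ, fun j => (hΦ j).1, fun v => ?_, hΦ'⟩
  rw [(hΦ 0).2.2 rfl]
  exact h0' v

/-- A graded chain map lifting zero is homotopic to zero through graded maps. -/
theorem exists_homotopy (F : GradedFreeResolution (n := n) ℳ) (G : GradedFreeResolution (n := n) 𝒩)
    {a : ℤ} (Θ : ∀ j, (Fin (F.rank j) → Poly n) →ₗ[Poly n] (Fin (G.rank j) → Poly n))
    (hΘ : ∀ j, IsGradedMap (F.c j) (G.c j) a (Θ j)) (h0 : ∀ v, G.aug (Θ 0 v) = 0)
    (hd : ∀ j v, G.diff j (Θ (j + 1) v) = Θ j (F.diff j v)) :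
    ∃ h : ∀ j, (Fin (F.rank j) → Poly n) →ₗ[Poly n] (Fin (G.rank (j + 1)) → Poly n),
      (∀ j, IsGradedMap (F.c j) (G.c (j + 1)) a (h j)) ∧ (∀ v, G.diff 0 (h 0 v) = Θ 0 v) ∧
        ∀ j v, G.diff (j + 1) (h (j + 1) v) = Θ (j + 1) v - h j (F.diff j v) := by
  obtain ⟨h₀, hg0, hh0⟩ := exists_graded_lift (freeGrading_isGradedModule (G.c 0))
    (c := F.c 0) (a := a) (G.diff 0) (G.diff_graded 0) (Θ 0) (hΘ 0)
    (fun v => (G.exact_zero _).1 (h0 v))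
  obtain ⟨h, hP, hQ⟩ := exists_dependent_seq
    (α := fun j => (Fin (F.rank j) → Poly n) →ₗ[Poly n] (Fin (G.rank (j + 1)) → Poly n))
    -- The second clause makes Θ_{j+1} - h_j d a map into the cycles of `G`, so that it can be
    -- lifted in the next step.
    (fun j h => IsGradedMap (F.c j) (G.c (j + 1)) a h ∧
      (∀ v, G.diff j (h (F.diff j v)) = Θ j (F.diff j v)) ∧ ∀ e : j = 0, h = e ▸ h₀)
    (fun j h h' => ∀ v, G.diff (j + 1) (h' v) = Θ (j + 1) v - h (F.diff j v))
    ⟨h₀, hg0, fun v => hh0 _, fun _ => rfl⟩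
    (by
      rintro j h ⟨hg, hr, -⟩
      obtain ⟨h', hg', hh'⟩ := exists_graded_lift (freeGrading_isGradedModule (G.c (j + 1)))
        (c := F.c (j + 1)) (a := a) (G.diff (j + 1)) (G.diff_graded (j + 1))
        (Θ (j + 1) - h ∘ₗ F.diff j)
        (fun k v hv => Submodule.sub_mem _ (hΘ _ _ _ hv) (hg _ _ (F.diff_graded j k v hv)))
        (fun v => (G.exact_succ j _).1 (by
          rw [LinearMap.sub_apply, map_sub, LinearMap.comp_apply, hr, hd, sub_self]))
      refine ⟨h', ⟨hg', fun v => ?_, fun e => by omega⟩, fun v => ?_⟩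
      · rw [hh', LinearMap.sub_apply, LinearMap.comp_apply, F.diff_diff, map_zero, sub_zero]
      · rw [hh', LinearMap.sub_apply, LinearMap.comp_apply])
  refine ⟨h, fun j => (hP j).1, fun v => ?_, hQ⟩
  rw [(hP 0).2.2 rfl]
  exact hh0 v

/-- If multiplication by `p` on `M` factors through `N`, then on resolutions it does so up to
homotopy. -/
theorem exists_factor_homotopy (F : GradedFreeResolution (n := n) ℳ)
    (G : GradedFreeResolution (n := n) 𝒩) (hℳ : IsGradedModule n ℳ) (h𝒩 : IsGradedModule n 𝒩)
    {a : ℤ} {p : Poly n} (hp : p ∈ polyGrading n a)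
    (φ : M →ₗ[Poly n] N) (hφ : ∀ k, ∀ m ∈ ℳ k, φ m ∈ 𝒩 k)
    (ψ : N →ₗ[Poly n] M) (hψ : ∀ k, ∀ m ∈ 𝒩 k, ψ m ∈ ℳ (k + a))
    (hψφ : ∀ m, ψ (φ m) = p • m) :
    ∃ (Φ : ∀ j, (Fin (F.rank j) → Poly n) →ₗ[Poly n] (Fin (G.rank j) → Poly n))
      (Ψ : ∀ j, (Fin (G.rank j) → Poly n) →ₗ[Poly n] (Fin (F.rank j) → Poly n))
      (h : ∀ j, (Fin (F.rank j) → Poly n) →ₗ[Poly n] (Fin (F.rank (j + 1)) → Poly n)),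
      (∀ j, IsGradedMap (G.c j) (F.c j) a (Ψ j)) ∧
      (∀ j, IsGradedMap (F.c j) (F.c (j + 1)) a (h j)) ∧
      (∀ v, F.diff 0 (h 0 v) = Ψ 0 (Φ 0 v) - p • v) ∧
      ∀ j v, F.diff (j + 1) (h (j + 1) v) =
        Ψ (j + 1) (Φ (j + 1) v) - p • v - h j (F.diff j v) := by
  obtain ⟨Φ, hΦg, hΦ0, hΦ⟩ := exists_chainMap F G h𝒩 (a := 0) φ (by simpa using hφ)
  obtain ⟨Ψ, hΨg, hΨ0, hΨ⟩ := exists_chainMap G F hℳ ψ hψ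
  obtain ⟨h, hg, hh0, hh⟩ := exists_homotopy F F (a := a)
    (fun j => Ψ j ∘ₗ Φ j - p • LinearMap.id)
    (fun j k v hv => Submodule.sub_mem _
      (by simpa using hΨg j _ _ (hΦg j k v hv))
      (by
        have := (freeGrading_isGradedModule (F.c j)).smul_mem _ _ p hp v hv
        rwa [add_comm] at this))
    (fun v => by
      simp [hΨ0, hΦ0, hψφ])
    (fun j v => by
      simp [hΨ, hΦ])
  exact ⟨Φ, Ψ, h, hΨg, hg, hh0, hh⟩

end GradedFreeResolution

end Comparison

/-! ### Minimal resolutions: retracts and the approximation theorem. -/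

section

section

variable {n : ℕ}

theorem apply_mem_of_mem_smul_top {M : Type*} [AddCommGroup M] [Module (Poly n) M]
    {I : Ideal (Poly n)} (f : M →ₗ[Poly n] Poly n) {v : M}
    (hv : v ∈ I • (⊤ : Submodule (Poly n) M)) : f v ∈ I := by
  refine Submodule.smul_induction_on hv (fun p hp m _ => ?_) (fun x y hx hy => ?_)
  · rw [map_smul, smul_eq_mul]
    exact I.mul_mem_right _ hp
  · rw [map_add]
    exact I.add_mem hx hy

/-- A homogeneous functional of degree `s`. -/
def IsGradedFunctional {r : ℕ} (c : Fin r → ℤ) (s : ℤ)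
    (f : (Fin r → Poly n) →ₗ[Poly n] Poly n) : Prop :=
  ∀ k, ∀ v ∈ freeGrading c k, f v ∈ polyGrading n (k + s)

theorem proj_isGradedFunctional {r : ℕ} (c : Fin r → ℤ) (i : Fin r) :
    IsGradedFunctional (n := n) c (-c i) (LinearMap.proj i) := fun _ _ hv =>
  mem_freeGrading.1 hv i

theorem IsGradedFunctional.comp {r r' : ℕ} {c : Fin r → ℤ} {c' : Fin r' → ℤ} {s a : ℤ}
    {f : (Fin r → Poly n) →ₗ[Poly n] Poly n} (hf : IsGradedFunctional c s f)
    {T : (Fin r' → Poly n) →ₗ[Poly n] (Fin r → Poly n)} (hT : IsGradedMap c' c a T) :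
    IsGradedFunctional c' (s + a) (f ∘ₗ T) := fun k v hv => by
  have := hf _ _ (hT k v hv)
  rwa [show k + a + s = k + (s + a) by ring] at this

theorem eq_zero_of_basis {r : ℕ} {f : (Fin r → Poly n) →ₗ[Poly n] Poly n}
    (h : ∀ i, f (Pi.single i 1) = 0) : f = 0 :=
  (Pi.basisFun (Poly n) (Fin r)).ext fun i => by simpa using h i

theorem IsGradedFunctional.eq_zero {r : ℕ} {c : Fin r → ℤ} {s : ℤ}
    {f : (Fin r → Poly n) →ₗ[Poly n] Poly n} (hf : IsGradedFunctional c s f)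
    (h : ∀ i, c i + s < 0) : f = 0 :=
  eq_zero_of_basis fun i => eq_zero_of_mem_polyGrading_neg (h i)
    (hf _ _ (single_one_mem_freeGrading c i))

end

variable {n : ℕ} {M N : Type*} [AddCommGroup M] [Module ℂ M] [Module (Poly n) M]
  [AddCommGroup N] [Module ℂ N] [Module (Poly n) N]
  {ℳ : ℤ → Submodule ℂ M} {𝒩 : ℤ → Submodule ℂ N}

theorem MinimalGradedFreeResolution.apply_diff_mem (F : MinimalGradedFreeResolution (n := n) ℳ)
    (j : ℕ) (f : (Fin (F.rank j) → Poly n) →ₗ[Poly n] Poly n) (v) :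
    f (F.diff j v) ∈ maxIdeal n :=
  apply_mem_of_mem_smul_top f (F.minimal j ⟨v, rfl⟩)

/-- Every linear map sends `𝔪`-multiples to `𝔪`-multiples. -/
theorem MinimalGradedFreeResolution.apply_map_diff_mem
    (F : MinimalGradedFreeResolution (n := n) ℳ) (j : ℕ) {r : ℕ}
    (T : (Fin (F.rank j) → Poly n) →ₗ[Poly n] (Fin r → Poly n)) (i : Fin r) (v) :
    T (F.diff j v) i ∈ maxIdeal n :=
  F.apply_diff_mem j (LinearMap.proj i ∘ₗ T) v

theorem MinimalGradedFreeResolution.exists_factor_homotopy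
    (F : MinimalGradedFreeResolution (n := n) ℳ)
    (G : GradedFreeResolution (n := n) 𝒩) (hℳ : IsGradedModule n ℳ) (h𝒩 : IsGradedModule n 𝒩)
    {a : ℤ} {p : Poly n} (hp : p ∈ polyGrading n a)
    (φ : M →ₗ[Poly n] N) (hφ : ∀ k, ∀ m ∈ ℳ k, φ m ∈ 𝒩 k)
    (ψ : N →ₗ[Poly n] M) (hψ : ∀ k, ∀ m ∈ 𝒩 k, ψ m ∈ ℳ (k + a))
    (hψφ : ∀ m, ψ (φ m) = p • m) :
    ∃ (Φ : ∀ j, (Fin (F.rank j) → Poly n) →ₗ[Poly n] (Fin (G.rank j) → Poly n))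
      (Ψ : ∀ j, (Fin (G.rank j) → Poly n) →ₗ[Poly n] (Fin (F.rank j) → Poly n))
      (h : ∀ j, (Fin (F.rank j) → Poly n) →ₗ[Poly n] (Fin (F.rank (j + 1)) → Poly n)),
      (∀ j, IsGradedMap (G.c j) (F.c j) a (Ψ j)) ∧
      (∀ j, IsGradedMap (F.c j) (F.c (j + 1)) a (h j)) ∧
      (∀ v, F.diff 0 (h 0 v) = Ψ 0 (Φ 0 v) - p • v) ∧
      ∀ j v, F.diff (j + 1) (h (j + 1) v) =
        Ψ (j + 1) (Φ (j + 1) v) - p • v - h j (F.diff j v) :=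
  F.toGraded.exists_factor_homotopy G hℳ h𝒩 hp φ hφ ψ hψ hψφ

/-- The degrees in a minimal resolution of a graded retract of `N` are bounded by the degrees in
any graded free resolution of `N`. -/
theorem MinimalGradedFreeResolution.exists_degree_le_of_retract
    (F : MinimalGradedFreeResolution (n := n) ℳ) (G : GradedFreeResolution (n := n) 𝒩)
    (hℳ : IsGradedModule n ℳ) (h𝒩 : IsGradedModule n 𝒩)
    (φ : M →ₗ[Poly n] N) (hφ : ∀ k, ∀ m ∈ ℳ k, φ m ∈ 𝒩 k)
    (ψ : N →ₗ[Poly n] M) (hψ : ∀ k, ∀ m ∈ 𝒩 k, ψ m ∈ ℳ k)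
    (hψφ : ∀ m, ψ (φ m) = m) (j : ℕ) (k : Fin (F.rank j)) :
    ∃ l : Fin (G.rank j), F.c j k ≤ G.c j l := by
  obtain ⟨Φ, Ψ, h, hΨ, -, h0, hs⟩ := F.exists_factor_homotopy G hℳ h𝒩
    (C_mem_polyGrading (1 : ℂ)) φ hφ ψ (by simpa using hψ) (by simpa using hψφ)
  by_contra! hlt
  -- All generators of G_j have degree below that of the k-th one of F_j, so row k of Ψ_j has
  -- entries of negative degree.
  have hz : (LinearMap.proj k : (Fin (F.rank j) → Poly n) →ₗ[Poly n] Poly n) ∘ₗ Ψ j = 0 :=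
    ((proj_isGradedFunctional (F.c j) k).comp (hΨ j)).eq_zero (fun l => by
      have := hlt l; omega)
  have hz' : ∀ v, Ψ j v k = 0 := fun v => LinearMap.congr_fun hz v
  -- Without the ΨΦ term, coordinate k of the homotopy identity at e_k writes -1 as a sum of
  -- coordinates of d h e_k and, for j > 0, h d e_k; by minimality these lie in 𝔪.
  apply one_notMem_maxIdeal (n := n)
  have h1 : (1 : Poly n) = (Pi.single k 1 : Fin (F.rank j) → Poly n) k := by simp
  rw [h1]
  have hmem := F.apply_diff_mem j (LinearMap.proj k) (h j (Pi.single k 1))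
  simp only [LinearMap.proj_apply] at hmem
  cases j with
  | zero =>
    have := congrFun (h0 (Pi.single k 1)) k
    simp only [Pi.sub_apply, hz', zero_sub, map_one, one_smul] at this
    rw [← neg_mem_iff, ← this]
    exact hmem
  | succ j =>
    have := congrFun (hs j (Pi.single k 1)) k
    simp only [Pi.sub_apply, hz', zero_sub, map_one, one_smul] at this
    have h2 := F.apply_map_diff_mem j (h j) k (Pi.single k 1)
    rw [← neg_mem_iff]
    have e : -(Pi.single k 1 : Fin (F.rank (j + 1)) → Poly n) k =
      F.diff (j + 1) (h (j + 1) (Pi.single k 1)) k + h j (F.diff j (Pi.single k 1)) k := by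
      rw [this]; ring
    rw [e]
    exact add_mem hmem h2

/-- Multiplication by the linear form `p` is homotopic to zero as far as functionals of degree
less than `-r - 1 - j` on `F_j` can see. -/
def MinimalGradedFreeResolution.LowNullhomotopic (F : MinimalGradedFreeResolution (n := n) ℳ)
    (r : ℤ) (p : Poly n) : Prop :=
  ∃ h : ∀ j, (Fin (F.rank j) → Poly n) →ₗ[Poly n] (Fin (F.rank (j + 1)) → Poly n),
    (∀ j, IsGradedMap (F.c j) (F.c (j + 1)) 1 (h j)) ∧
    (∀ s f, IsGradedFunctional (F.c 0) s f → s + 1 + r < 0 →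
      ∀ v, p * f v = -f (F.diff 0 (h 0 v))) ∧
    ∀ (j : ℕ) (s : ℤ) (f), IsGradedFunctional (F.c (j + 1)) s f → s + (j + 1 : ℕ) + 1 + r < 0 →
      ∀ v, p * f v = -f (F.diff (j + 1) (h (j + 1) v)) - f (h j (F.diff j v))

/-- A functional of degree s on F_j pulls back along Ψ_j to degree s + 1 on G_j, whose generators
have degree at most r + j. When s + 1 + r + j < 0 the pullback vanishes, so the ΨΦ term drops out of
the homotopy identity. -/
theorem MinimalGradedFreeResolution.lowNullhomotopic_of_factor
    (F : MinimalGradedFreeResolution (n := n) ℳ) (G : GradedFreeResolution (n := n) 𝒩)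
    (hℳ : IsGradedModule n ℳ) (h𝒩 : IsGradedModule n 𝒩) {p : Poly n} (hp : p ∈ polyGrading n 1)
    (φ : M →ₗ[Poly n] N) (hφ : ∀ k, ∀ m ∈ ℳ k, φ m ∈ 𝒩 k)
    (ψ : N →ₗ[Poly n] M) (hψ : ∀ k, ∀ m ∈ 𝒩 k, ψ m ∈ ℳ (k + 1))
    (hψφ : ∀ m, ψ (φ m) = p • m) {r : ℤ} (hG : ∀ j k, G.c j k ≤ r + j) :
    F.LowNullhomotopic r p := by
  obtain ⟨Φ, Ψ, h, hΨ, hh, h0, hs⟩ := F.exists_factor_homotopy G hℳ h𝒩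
    hp φ hφ ψ hψ hψφ
  have hz : ∀ j s f, IsGradedFunctional (F.c j) s f → s + j + 1 + r < 0 → ∀ v, f (Ψ j v) = 0 :=
    fun j s f hf hlt v => by
      have := (hf.comp (hΨ j)).eq_zero (fun l => by have := hG j l; omega)
      exact LinearMap.congr_fun this v
  refine ⟨h, hh, fun s f hf hlt v => ?_, fun j s f hf hlt v => ?_⟩
  · rw [h0, map_sub, hz 0 s f hf (by simpa using hlt), map_smul, smul_eq_mul]
    ring
  · rw [hs, map_sub, map_sub, hz (j + 1) s f hf (by simpa using hlt), map_smul, smul_eq_mul]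
    ring

/-- The ideal of the first `t` elements of a sequence. -/
def initIdeal (z : ℕ → Poly n) (t : ℕ) : Ideal (Poly n) := Ideal.span (z '' Set.Iio t)

theorem initIdeal_zero (z : ℕ → Poly n) : initIdeal z 0 = ⊥ := by
  simp [initIdeal]

theorem initIdeal_succ (z : ℕ → Poly n) (t : ℕ) :
    initIdeal z (t + 1) = initIdeal z t ⊔ Ideal.span {z t} := by
  rw [initIdeal, initIdeal, ← Ideal.span_union, Set.union_comm]
  congr 1
  ext p
  simp only [Set.mem_image, Set.mem_Iio, Set.mem_union, Set.mem_singleton_iff]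
  constructor
  · rintro ⟨a, ha, rfl⟩
    rcases Nat.lt_succ_iff_lt_or_eq.1 ha with h | rfl
    · exact Or.inr ⟨a, h, rfl⟩
    · exact Or.inl rfl
  · rintro (rfl | ⟨a, ha, rfl⟩)
    · exact ⟨t, by omega, rfl⟩
    · exact ⟨a, by omega, rfl⟩

theorem initIdeal_mono (z : ℕ → Poly n) {s t : ℕ} (h : s ≤ t) : initIdeal z s ≤ initIdeal z t :=
  Ideal.span_mono (Set.image_mono (Set.Iio_subset_Iio h))

theorem mem_initIdeal (z : ℕ → Poly n) {s t : ℕ} (h : s < t) : z s ∈ initIdeal z t :=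
  Ideal.subset_span ⟨s, h, rfl⟩

theorem mem_initIdeal_succ {z : ℕ → Poly n} {t : ℕ} {p : Poly n} :
    p ∈ initIdeal z (t + 1) ↔ ∃ q, p - z t * q ∈ initIdeal z t := by
  rw [initIdeal_succ, Submodule.mem_sup]
  constructor
  · rintro ⟨a, ha, b, hb, rfl⟩
    obtain ⟨q, rfl⟩ := Ideal.mem_span_singleton'.1 hb
    exact ⟨q, by rw [mul_comm]; simpa using ha⟩
  · rintro ⟨q, hq⟩
    exact ⟨_, hq, z t * q, Ideal.mem_span_singleton.2 ⟨q, rfl⟩, by ring⟩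

/-- A functional with values in `I_{t+1}` is a multiple of `z_t` modulo functionals with values in
`I_t`. -/
theorem exists_functional_of_mem_initIdeal_succ {z : ℕ → Poly n} {t r : ℕ}
    (f : (Fin r → Poly n) →ₗ[Poly n] Poly n) (hf : ∀ v, f v ∈ initIdeal z (t + 1)) :
    ∃ g : (Fin r → Poly n) →ₗ[Poly n] Poly n, ∀ v, f v - z t * g v ∈ initIdeal z t := by
  choose q hq using fun i => mem_initIdeal_succ.1 (hf (Pi.single i 1))
  refine ⟨(Pi.basisFun (Poly n) (Fin r)).constr (Poly n) q, fun v => ?_⟩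
  have hg : ∀ i, (Pi.basisFun (Poly n) (Fin r)).constr (Poly n) q (Pi.single i 1) = q i :=
    fun i => by
      have := (Pi.basisFun (Poly n) (Fin r)).constr_basis (Poly n) q i
      rwa [Pi.basisFun_apply] at this
  rw [pi_eq_sum_smul_single v]
  simp only [map_sum, map_smul, smul_eq_mul, hg, Finset.mul_sum, ← Finset.sum_sub_distrib]
  refine Ideal.sum_mem _ fun i _ => ?_
  rw [show v i * f (Pi.single i 1) - z t * (v i * q i) =
    v i * (f (Pi.single i 1) - z t * q i) by ring]
  exact Ideal.mul_mem_left _ _ (hq i)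

namespace MinimalGradedFreeResolution

/-- A functional on `F_i` is, modulo functionals with values in `I`, the composition of the
differential with a functional on `F_{i-1}` (or zero, if `i = 0`). -/
def IsCoboundaryMod (F : MinimalGradedFreeResolution (n := n) ℳ) (I : Ideal (Poly n)) :
    (i : ℕ) → ((Fin (F.rank i) → Poly n) →ₗ[Poly n] Poly n) → Prop
  | 0, f => ∀ v, f v ∈ I
  | i + 1, f => ∃ g : (Fin (F.rank i) → Poly n) →ₗ[Poly n] Poly n,
      ∀ v, f v - g (F.diff i v) ∈ I

/-- Modulo I_t the homotopy for z_t gives z_t f ≡ -(f h) d, so f h is a cocycle modulo I_{t+1} one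
position lower. Its degree rises by one, which leaves the numerical condition unchanged. Induction
makes f h a coboundary modulo I_{t+1}, and cancelling z_t makes f one modulo I_t. Each step down
uses one more member of the sequence, hence t + i < ρ. -/
theorem isCoboundaryMod_of_cocycle (F : MinimalGradedFreeResolution (n := n) ℳ) {ρ : ℕ}
    {z : ℕ → Poly n} {r : ℤ}
    (hreg : ∀ t < ρ, ∀ p, z t * p ∈ initIdeal z t → p ∈ initIdeal z t)
    (hnull : ∀ t < ρ, F.LowNullhomotopic r (z t)) (i : ℕ) :
    ∀ (t : ℕ) (s : ℤ) (f), t + i < ρ → IsGradedFunctional (F.c i) s f → s + i + 1 + r < 0 →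
      (∀ v, f (F.diff i v) ∈ initIdeal z t) → F.IsCoboundaryMod (initIdeal z t) i f := by
  induction i with
  | zero =>
    intro t s f ht hf hs hv v
    obtain ⟨h, -, h0, -⟩ := hnull t (by omega)
    apply hreg t (by omega)
    rw [h0 s f hf (by simpa using hs)]
    exact neg_mem (hv _)
  | succ i ih =>
    intro t s f ht hf hs hv
    obtain ⟨h, hh, -, h1⟩ := hnull t (by omega)
    have key : ∀ v, f (h i (F.diff i v)) =
        -(z t * f v) - f (F.diff (i + 1) (h (i + 1) v)) := fun v => by
      rw [h1 i s f hf hs]; ring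
    have hcob := ih (t + 1) (s + 1) (f ∘ₗ h i) (by omega) (hf.comp (hh i))
      (by push_cast at hs; linarith) (fun v => by
        rw [LinearMap.comp_apply, key]
        exact sub_mem (neg_mem (Ideal.mul_mem_right _ _ (mem_initIdeal z (Nat.lt_succ_self t))))
          (initIdeal_mono z (Nat.le_succ t) (hv _)))
    -- Write f h as a coboundary plus z_t g modulo I_t; composing with d removes the coboundary.
    obtain ⟨g, hg⟩ : ∃ g : (Fin (F.rank i) → Poly n) →ₗ[Poly n] Poly n,
        ∀ v, f (h i (F.diff i v)) - z t * g (F.diff i v) ∈ initIdeal z t := by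
      cases i with
      | zero =>
        obtain ⟨g, hg⟩ := exists_functional_of_mem_initIdeal_succ _ hcob
        exact ⟨g, fun v => hg _⟩
      | succ i =>
        obtain ⟨g', hg'⟩ := hcob
        obtain ⟨g, hg⟩ := exists_functional_of_mem_initIdeal_succ (z := z) (t := t)
          (f ∘ₗ h (i + 1) - g' ∘ₗ F.diff i) hg'
        refine ⟨g, fun v => ?_⟩
        have := hg (F.diff (i + 1) v)
        have hdd : F.diff i (F.diff (i + 1) v) = 0 := F.toGraded.diff_diff i v
        simpa [hdd] using this
    -- Now z_t (f + g d) takes values in I_t, and z_t can be cancelled.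
    refine ⟨-g, fun v => hreg t (by omega) _ ?_⟩
    have := hg v
    rw [key] at this
    have h2 := neg_mem (add_mem this (hv (h (i + 1) v)))
    convert h2 using 1
    simp only [LinearMap.neg_apply]
    ring

/-- The approximation theorem: if multiplication by each member of a sufficiently long regular
sequence of linear forms factors through an `r`-regular module, then the degrees of the minimal
resolution are bounded as for an `(r + 1)`-regular module. -/
theorem degree_le_of_lowNullhomotopic (F : MinimalGradedFreeResolution (n := n) ℳ) {ρ : ℕ}
    {z : ℕ → Poly n} {r : ℤ} (hlen : ∀ j, ρ ≤ j → F.rank j = 0)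
    (hreg : ∀ t < ρ, ∀ p, z t * p ∈ initIdeal z t → p ∈ initIdeal z t)
    (hnull : ∀ t < ρ, F.LowNullhomotopic r (z t)) (j : ℕ) (k : Fin (F.rank j)) :
    F.c j k ≤ r + 1 + j := by
  -- Descending induction on j, starting where the resolution is zero.
  obtain ⟨m, hm⟩ : ∃ m, ρ ≤ j + m := ⟨ρ, by omega⟩
  induction m generalizing j with
  | zero =>
    have := hlen j hm
    exact absurd k.2 (by omega)
  | succ m ih =>
    by_cases hj : ρ ≤ j
    · have := hlen j hj
      exact absurd k.2 (by omega)
    by_contra! hlt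
    -- The bound in position j + 1 forces the entries of row k of the differential to have degree at
    -- most 0; they also lie in 𝔪, so they vanish and the k-th coordinate is a cocycle.
    have hcoc : (LinearMap.proj k : (Fin (F.rank j) → Poly n) →ₗ[Poly n] Poly n) ∘ₗ F.diff j
        = 0 := by
      refine eq_zero_of_basis fun l => ?_
      refine eq_zero_of_mem_maxIdeal_of_nonpos (k := F.c (j + 1) l - F.c j k) ?_ ?_
        (F.apply_diff_mem j (LinearMap.proj k) _)
      · have := ih (j + 1) l (by omega)
        push_cast at this
        omega
      · exact mem_freeGrading.1
          (F.diff_graded j _ _ (single_one_mem_freeGrading (F.c (j + 1)) l)) k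
    -- For t = 0 the ideal is zero, so the coordinate is an actual coboundary g d. By minimality g d
    -- has values in 𝔪, yet the coordinate takes the value 1 at e_k.
    have hcob := F.isCoboundaryMod_of_cocycle hreg hnull j 0 (-F.c j k) (LinearMap.proj k)
      (by omega) (proj_isGradedFunctional _ k) (by omega) (fun v => by
        have := LinearMap.congr_fun hcoc v
        simp only [LinearMap.comp_apply, LinearMap.zero_apply] at this
        rw [this]; exact zero_mem _)
    rw [initIdeal_zero] at hcob
    cases j with
    | zero =>
      have := hcob (Pi.single k 1)
      simp at this
    | succ j =>
      obtain ⟨g, hg⟩ := hcob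
      have h1 := hg (Pi.single k 1)
      have h2 := F.apply_diff_mem j g (Pi.single k 1)
      simp only [LinearMap.proj_apply, Pi.single_eq_same, Submodule.mem_bot] at h1
      rw [← sub_eq_zero.1 h1] at h2
      exact one_notMem_maxIdeal h2

end MinimalGradedFreeResolution

end

/-! ### The length of a minimal resolution. -/

section

variable {n : ℕ} {M : Type*} [AddCommGroup M] [Module (Poly n) M]

theorem mem_smul_top_pi_iff {r : ℕ} {I : Ideal (Poly n)} {v : Fin r → Poly n} :
    v ∈ I • (⊤ : Submodule (Poly n) (Fin r → Poly n)) ↔ ∀ i, v i ∈ I := by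
  constructor
  · intro h i
    exact apply_mem_of_mem_smul_top (LinearMap.proj i) h
  · intro h
    rw [pi_eq_sum_smul_single v]
    exact Submodule.sum_mem _ fun i _ => Submodule.smul_mem_smul (h i) Submodule.mem_top

theorem mem_initIdeal_succ_smul_top {z : ℕ → Poly n} {t : ℕ} {v : M} :
    v ∈ initIdeal z (t + 1) • (⊤ : Submodule (Poly n) M) ↔
      ∃ u, v - z t • u ∈ initIdeal z t • (⊤ : Submodule (Poly n) M) := by
  rw [initIdeal_succ, Submodule.sup_smul, Submodule.mem_sup]
  constructor
  · rintro ⟨a, ha, b, hb, rfl⟩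
    rw [Submodule.ideal_span_singleton_smul] at hb
    obtain ⟨u, -, rfl⟩ := Submodule.mem_smul_pointwise_iff_exists _ _ _ |>.1 hb
    exact ⟨u, by simpa using ha⟩
  · rintro ⟨u, hu⟩
    exact ⟨_, hu, z t • u, Submodule.smul_mem_smul (Ideal.mem_span_singleton_self _)
      Submodule.mem_top, by abel⟩

theorem map_mem_smul_top {N : Type*} [AddCommGroup N] [Module (Poly n) N] {I : Ideal (Poly n)}
    (f : M →ₗ[Poly n] N) {v : M} (hv : v ∈ I • (⊤ : Submodule (Poly n) M)) :
    f v ∈ I • (⊤ : Submodule (Poly n) N) := by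
  have := Submodule.mem_map_of_mem (f := f) hv
  rw [Submodule.map_smul''] at this
  exact Submodule.smul_mono le_rfl le_top this

end

section

variable {n : ℕ} {M : Type*} [AddCommGroup M] [Module ℂ M] [Module (Poly n) M]
  {ℳ : ℤ → Submodule ℂ M}

namespace GradedFreeResolution

/-- Right exactness of reduction modulo I: an element of I M lifts to I F_0 because the augmentation
is onto. -/
theorem exact_aug_mod (F : GradedFreeResolution (n := n) ℳ) (I : Ideal (Poly n)) (v)
    (hv : F.aug v ∈ I • (⊤ : Submodule (Poly n) M)) :
    ∃ w, v - F.diff 0 w ∈ I • (⊤ : Submodule (Poly n) (Fin (F.rank 0) → Poly n)) := by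
  have h : F.aug v ∈ Submodule.map F.aug (I • ⊤) := by
    rwa [Submodule.map_smul'', Submodule.map_top, LinearMap.range_eq_top.2 F.aug_surjective]
  obtain ⟨u, hu, huv⟩ := h
  obtain ⟨w, hw⟩ := (F.exact_zero (v - u)).1 (by rw [map_sub, huv, sub_self])
  exact ⟨w, by rw [hw]; simpa using hu⟩

/-- A resolution stays exact in high degrees modulo a regular sequence. -/
theorem exact_mod_initIdeal (F : GradedFreeResolution (n := n) ℳ) {z : ℕ → Poly n} {N m : ℕ}
    (hR : ∀ t < N, ∀ p, z t * p ∈ initIdeal z t → p ∈ initIdeal z t)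
    (hM : ∀ t < m, ∀ x : M, z t • x ∈ initIdeal z t • (⊤ : Submodule (Poly n) M) →
      x ∈ initIdeal z t • (⊤ : Submodule (Poly n) M)) (t : ℕ) :
    t ≤ N → ∀ i, t ≤ m + i → ∀ v : Fin (F.rank (i + 1)) → Poly n,
      F.diff i v ∈ initIdeal z t • (⊤ : Submodule (Poly n) (Fin (F.rank i) → Poly n)) →
      ∃ w, v - F.diff (i + 1) w ∈
        initIdeal z t • (⊤ : Submodule (Poly n) (Fin (F.rank (i + 1)) → Poly n)) := by
  -- The claim is the vanishing of Tor_{i+1}(M, R/I_t) for t ≤ m + i.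
  induction t with
  | zero =>
    intro _ i _ v hv
    rw [initIdeal_zero, Submodule.bot_smul, Submodule.mem_bot] at hv
    obtain ⟨w, hw⟩ := (F.exact_succ i v).1 hv
    exact ⟨w, by simp [hw]⟩
  | succ t ih =>
    intro ht i hi v hv
    obtain ⟨u, hu⟩ := mem_initIdeal_succ_smul_top.1 hv
    -- Since d v ≡ z_t u modulo I_t, applying the next map shows that z_t kills the image of u
    -- modulo I_t. Regularity on the free module, or on M when i = 0, makes u a cycle modulo I_t,
    -- hence a boundary d w one position lower. Then v - z_t w is a cycle modulo I_t.
    obtain ⟨w, hw⟩ : ∃ w, u - F.diff i w ∈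
        initIdeal z t • (⊤ : Submodule (Poly n) (Fin (F.rank i) → Poly n)) := by
      cases i with
      | zero =>
        apply F.exact_aug_mod
        apply hM t (by omega)
        have := neg_mem (map_mem_smul_top F.aug hu)
        simpa [F.aug_diff] using this
      | succ i =>
        apply ih (by omega) i (by omega)
        have := neg_mem (map_mem_smul_top (F.diff i) hu)
        rw [map_sub, F.diff_diff, zero_sub, neg_neg, map_smul] at this
        rw [mem_smul_top_pi_iff] at this ⊢
        exact fun l => hR t (by omega) _ (this l)
    obtain ⟨w', hw'⟩ := ih (by omega) i (by omega) (v - z t • w) (by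
      rw [map_sub, map_smul]
      have := add_mem hu (Submodule.smul_mem _ (z t) hw)
      convert this using 1
      rw [smul_sub]; abel)
    refine ⟨w', mem_initIdeal_succ_smul_top.2 ⟨w, ?_⟩⟩
    convert hw' using 1
    abel

end GradedFreeResolution

/-- The length of a minimal resolution is bounded by the number of variables minus the depth. -/
theorem MinimalGradedFreeResolution.rank_eq_zero_of_regular
    (F : MinimalGradedFreeResolution (n := n) ℳ) {z : ℕ → Poly n} {N m : ℕ}
    (hz : initIdeal z N = maxIdeal n)
    (hR : ∀ t < N, ∀ p, z t * p ∈ initIdeal z t → p ∈ initIdeal z t)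
    (hM : ∀ t < m, ∀ x : M, z t • x ∈ initIdeal z t • (⊤ : Submodule (Poly n) M) →
      x ∈ initIdeal z t • (⊤ : Submodule (Poly n) M)) (j : ℕ) (hj : N ≤ m + j) :
    F.rank (j + 1) = 0 := by
  by_contra hne
  let k : Fin (F.rank (j + 1)) := ⟨0, Nat.pos_of_ne_zero hne⟩
  -- By minimality e_k is a cycle modulo 𝔪, so by exactness a boundary modulo 𝔪; but boundaries lie
  -- in 𝔪 F as well.
  obtain ⟨w, hw⟩ : ∃ w, Pi.single k 1 - F.diff (j + 1) w ∈
      initIdeal z N • (⊤ : Submodule (Poly n) (Fin (F.rank (j + 1)) → Poly n)) :=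
    F.toGraded.exact_mod_initIdeal hR hM N le_rfl j hj (Pi.single k 1) (by
      rw [hz]
      exact F.minimal j ⟨_, rfl⟩)
  rw [hz] at hw
  have h1 := add_mem (apply_mem_of_mem_smul_top (LinearMap.proj k) hw)
    (F.apply_diff_mem (j + 1) (LinearMap.proj k) w)
  rw [map_sub, sub_add_cancel] at h1
  rw [LinearMap.proj_apply] at h1
  exact one_notMem_maxIdeal h1

end

/-! ### Existence of minimal graded free resolutions. -/

section Existence

variable {n : ℕ}

theorem constantCoeff_polyProj_zero (p : Poly n) :
    constantCoeff (polyProj n 0 p) = constantCoeff p := by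
  classical
  rw [constantCoeff_eq, polyProj, coeff_weightedHomogeneousComponent]
  simp

/-- A homogeneous generating family of a graded module. -/
def HasHomogeneousGenerators {M : Type*} [AddCommGroup M] [Module ℂ M] [Module (Poly n) M]
    (ℳ : ℤ → Submodule ℂ M) (r : ℕ) : Prop :=
  ∃ (g : Fin r → M) (c : Fin r → ℤ), (∀ i, g i ∈ ℳ (c i)) ∧
    Submodule.span (Poly n) (Set.range g) = ⊤

theorem exists_hasHomogeneousGenerators {M : Type*} [AddCommGroup M] [Module ℂ M]
    [Module (Poly n) M] {ℳ : ℤ → Submodule ℂ M} (hℳ : IsGradedModule n ℳ)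
    [Module.Finite (Poly n) M] : ∃ r, HasHomogeneousGenerators (n := n) ℳ r := by
  obtain ⟨π, hπ⟩ := hℳ.exists_proj
  have hspan : Submodule.span (Poly n) {m : M | ∃ k, m ∈ ℳ k} = ⊤ := by
    rw [eq_top_iff]
    intro m _
    obtain ⟨s, hs⟩ := hπ.exists_sum m
    rw [hs]
    exact Submodule.sum_mem _ fun k _ => Submodule.subset_span ⟨k, hπ.mem k m⟩
  have hfg : (Submodule.span (Poly n) {m : M | ∃ k, m ∈ ℳ k}).FG := by
    rw [hspan]; exact Module.Finite.fg_top
  obtain ⟨S, hS, hS'⟩ := (Submodule.fg_span_iff_fg_span_finset_subset _).1 hfg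
  choose c hc using fun m : S => hS m.2
  refine ⟨S.card, fun i => (S.equivFin.symm i : M), fun i => c (S.equivFin.symm i),
    fun i => hc _, ?_⟩
  rw [← hspan, hS']
  congr 1
  ext m
  constructor
  · rintro ⟨i, rfl⟩; exact (S.equivFin.symm i).2
  · intro hm; exact ⟨S.equivFin ⟨m, hm⟩, by simp⟩

/-- A finitely generated graded module has a minimal graded free cover. -/
theorem exists_minimal_cover {M : Type*} [AddCommGroup M] [Module ℂ M]
    [Module (Poly n) M] {ℳ : ℤ → Submodule ℂ M} (hℳ : IsGradedModule n ℳ)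
    [Module.Finite (Poly n) M] :
    ∃ (r : ℕ) (c : Fin r → ℤ) (p : (Fin r → Poly n) →ₗ[Poly n] M),
      (∀ k, ∀ v ∈ freeGrading c k, p v ∈ ℳ k) ∧ Function.Surjective p ∧
        LinearMap.ker p ≤ maxIdeal n • (⊤ : Submodule (Poly n) (Fin r → Poly n)) := by
  classical
  have hex := exists_hasHomogeneousGenerators hℳ
  -- Minimality of the cover comes from taking the least possible number of homogeneous generators.
  obtain ⟨g, c, hg, hspan⟩ := Nat.find_spec hex
  have hmin := fun m => Nat.find_min hex (m := m)
  generalize Nat.find hex = r at g c hg hspan hmin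
  let p := Fintype.linearCombination (Poly n) g
  have hpi : ∀ i, p (Pi.single i 1) = g i := fun i => by
    simp [p, Fintype.linearCombination_apply_single]
  have hpg : ∀ k, ∀ v ∈ freeGrading c k, p v ∈ ℳ k := fun k v hv => by
    have := graded_of_basis hℳ c 0 p (fun i => by rw [hpi, add_zero]; exact hg i) k v hv
    rwa [add_zero] at this
  refine ⟨r, c, p, hpg, ?_, fun v hv => ?_⟩
  · rw [← LinearMap.range_eq_top, Fintype.range_linearCombination, hspan]
  · obtain ⟨π, hπ⟩ := hℳ.exists_proj
    rw [mem_smul_top_pi_iff]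
    by_contra! hcon
    obtain ⟨i, hi⟩ := hcon
    -- The component of degree c_i of the relation v has the constant term of v_i as its i-th
    -- coefficient. If this is nonzero, g_i is a combination of the other generators and can be
    -- discarded.
    have hv' : p (freeProj c (c i) v) = 0 :=
      ker_stable (freeProj_gradedProj c) hπ (a := 0) p.toAddMonoidHom
        (fun k m hm => by simpa using hpg k m hm) _ v hv
    have hvi : freeProj c (c i) v i = C (constantCoeff (v i)) := by
      rw [freeProj_apply, sub_self,
        eq_C_of_mem_polyGrading_zero ((polyProj_gradedProj n).mem 0 (v i)),
        constantCoeff_polyProj_zero]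
    rw [mem_maxIdeal_iff] at hi
    cases r with
    | zero => exact i.elim0
    | succ r =>
      refine hmin r (Nat.lt_succ_self r) ⟨g ∘ i.succAbove, c ∘ i.succAbove,
        fun l => hg _, ?_⟩
      rw [eq_top_iff, ← hspan, Submodule.span_le]
      have hl : ∀ l, g (i.succAbove l) ∈
          Submodule.span (Poly n) (Set.range (g ∘ i.succAbove)) :=
        fun l => Submodule.subset_span ⟨l, rfl⟩
      rintro _ ⟨l, rfl⟩
      rcases eq_or_ne l i with rfl | hne
      · have hsum : p (freeProj c (c l) v) = (C (constantCoeff (v l)) : Poly n) • g l +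
            ∑ x, freeProj c (c l) v (l.succAbove x) • g (l.succAbove x) := by
          simp only [p, Fintype.linearCombination_apply]
          rw [Fin.sum_univ_succAbove _ l, hvi]
        rw [hv'] at hsum
        have e : g l = (C (constantCoeff (v l))⁻¹ : Poly n) •
            -∑ x, freeProj c (c l) v (l.succAbove x) • g (l.succAbove x) := by
          rw [← eq_neg_of_add_eq_zero_left hsum.symm, smul_smul, ← C_mul,
            inv_mul_cancel₀ hi, C_1, one_smul]
        rw [e]
        exact Submodule.smul_mem _ _ (neg_mem (Submodule.sum_mem _ fun x _ =>
          Submodule.smul_mem _ _ (hl x)))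
      · obtain ⟨x, rfl⟩ := Fin.exists_succAbove_eq hne
        exact hl x

/-- A graded submodule of a graded free module contained in `𝔪` times it. -/
structure MinimalSyzygy (n : ℕ) where
  /-- rank of the ambient module -/
  r : ℕ
  /-- degrees of the basis -/
  c : Fin r → ℤ
  /-- the submodule -/
  K : Submodule (Poly n) (Fin r → Poly n)
  stable : ∀ k, ∀ v ∈ K, freeProj c k v ∈ K
  le : K ≤ maxIdeal n • (⊤ : Submodule (Poly n) (Fin r → Poly n))

theorem MinimalSyzygy.exists_next (S : MinimalSyzygy n) :
    ∃ (S' : MinimalSyzygy n) (d : (Fin S'.r → Poly n) →ₗ[Poly n] (Fin S.r → Poly n)),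
      (∀ k, ∀ v ∈ freeGrading S'.c k, d v ∈ freeGrading S.c k) ∧ LinearMap.range d = S.K ∧
        LinearMap.ker d = S'.K := by
  have hK := subGrading_isGradedModule (freeGrading_isGradedModule S.c)
    (freeProj_gradedProj S.c) S.K S.stable
  obtain ⟨r, c, p, hp, hsurj, hker⟩ := exists_minimal_cover hK
  have hd : ∀ k, ∀ v ∈ freeGrading c k, (S.K.subtype ∘ₗ p) v ∈ freeGrading S.c k :=
    fun k v hv => hp k v hv
  refine ⟨⟨r, c, LinearMap.ker (S.K.subtype ∘ₗ p), fun k v hv =>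
    ker_stable (freeProj_gradedProj c) (freeProj_gradedProj S.c) (a := 0)
      (S.K.subtype ∘ₗ p).toAddMonoidHom (fun k m hm => by simpa using hd k m hm) k v hv, ?_⟩,
    S.K.subtype ∘ₗ p, hd, ?_, rfl⟩
  · rw [LinearMap.ker_comp_of_ker_eq_bot _ (Submodule.ker_subtype _)]
    exact hker
  · rw [LinearMap.range_comp_of_range_eq_top _ (LinearMap.range_eq_top.2 hsurj),
      Submodule.range_subtype]

/-- Every finitely generated graded module has a minimal graded free resolution. -/
theorem nonempty_minimalGradedFreeResolution {M : Type*} [AddCommGroup M] [Module ℂ M]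
    [Module (Poly n) M] {ℳ : ℤ → Submodule ℂ M} (hℳ : IsGradedModule n ℳ)
    [Module.Finite (Poly n) M] : Nonempty (MinimalGradedFreeResolution (n := n) ℳ) := by
  obtain ⟨r, c, p, hp, hsurj, hker⟩ := exists_minimal_cover hℳ
  obtain ⟨π, hπ⟩ := hℳ.exists_proj
  let S₀ : MinimalSyzygy n := ⟨r, c, LinearMap.ker p, fun k v hv =>
    ker_stable (freeProj_gradedProj c) hπ (a := 0) p.toAddMonoidHom
      (fun k m hm => by simpa using hp k m hm) k v hv, hker⟩
  choose next d hd hrange hkerd using fun S : MinimalSyzygy n => S.exists_next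
  let S : ℕ → MinimalSyzygy n := fun j => Nat.rec S₀ (fun _ S => next S) j
  exact ⟨{
    rank := fun j => (S j).r
    c := fun j => (S j).c
    diff := fun j => d (S j)
    aug := p
    diff_graded := fun j => hd (S j)
    aug_graded := hp
    aug_surjective := hsurj
    exact_zero := LinearMap.exact_iff.2 (hrange S₀).symm
    exact_succ := fun j => LinearMap.exact_iff.2 ((hkerd (S j)).trans (hrange (S (j + 1))).symm)
    minimal := fun j => (hrange (S j)).trans_le (S j).le }⟩

end Existence

/-! ### Linear forms, substitution along a vector, and primality. -/

section LinearForms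

variable {n : ℕ}

/-- The linear form `φ` applied to a vector of polynomials. -/
def dotForm (φ : Module.Dual ℂ (Fin n → ℂ)) : (Fin n → Poly n) →ₗ[Poly n] Poly n :=
  ∑ i : Fin n, (C (φ (Pi.single i 1)) : Poly n) • LinearMap.proj i

theorem dotForm_apply (φ : Module.Dual ℂ (Fin n → ℂ)) (θ : Fin n → Poly n) :
    dotForm φ θ = ∑ i : Fin n, C (φ (Pi.single i 1)) * θ i := by
  simp [dotForm]

theorem dual_apply_eq_sum (φ : Module.Dual ℂ (Fin n → ℂ)) (v : Fin n → ℂ) :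
    φ v = ∑ i, φ (Pi.single i 1) * v i := by
  conv_lhs => rw [pi_eq_sum_univ' v]
  simp [map_sum, mul_comm]

/-- The linear polynomial of a linear form, as a linear map. -/
def linearPolyHom (n : ℕ) : Module.Dual ℂ (Fin n → ℂ) →ₗ[ℂ] Poly n where
  toFun := linearPoly
  map_add' φ ψ := by simp [linearPoly, add_mul, Finset.sum_add_distrib]
  map_smul' a φ := by simp [linearPoly, Finset.smul_sum, smul_eq_C_mul, mul_assoc]

theorem linearPoly_mem_polyGrading (φ : Module.Dual ℂ (Fin n → ℂ)) :
    linearPoly φ ∈ polyGrading n 1 :=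
  Submodule.sum_mem _ fun i _ => by
    have := polyGrading_mul (C_mem_polyGrading (φ (Pi.single i 1))) (X_mem_polyGrading i)
    rwa [zero_add] at this

theorem pderiv_linearPoly (φ : Module.Dual ℂ (Fin n → ℂ)) (i : Fin n) :
    pderiv i (linearPoly φ) = C (φ (Pi.single i 1)) := by
  simp [linearPoly, pderiv_X, Pi.single_apply]

theorem linearPoly_ne_zero {φ : Module.Dual ℂ (Fin n → ℂ)} (hφ : φ ≠ 0) : linearPoly φ ≠ 0 := by
  intro h
  apply hφ
  ext i
  have := pderiv_linearPoly φ i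
  rw [h, map_zero] at this
  simpa using this.symm

/-- The substitution `x ↦ x - φ(x) v`, which is a projection along `v` if `φ(v) = 1`. -/
def substForm (φ : Module.Dual ℂ (Fin n → ℂ)) (v : Fin n → ℂ) : Poly n →ₐ[ℂ] Poly n :=
  aeval fun i => X i - C (v i) * linearPoly φ

theorem substForm_linearPoly (φ ψ : Module.Dual ℂ (Fin n → ℂ)) (v : Fin n → ℂ) :
    substForm φ v (linearPoly ψ) = linearPoly ψ - C (ψ v) * linearPoly φ := by
  have h : substForm φ v (linearPoly ψ) =
      ∑ i, C (ψ (Pi.single i 1)) * (X i - C (v i) * linearPoly φ) := by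
    simp [linearPoly, substForm, algebraMap_eq]
  rw [h, dual_apply_eq_sum ψ v]
  simp only [mul_sub, Finset.sum_sub_distrib, map_sum, Finset.sum_mul, map_mul, mul_assoc]
  rfl

theorem substForm_linearPoly_of_eq_zero {φ ψ : Module.Dual ℂ (Fin n → ℂ)} {v : Fin n → ℂ}
    (h : ψ v = 0) : substForm φ v (linearPoly ψ) = linearPoly ψ := by
  rw [substForm_linearPoly, h, C_0, zero_mul, sub_zero]

theorem substForm_linearPoly_self {φ : Module.Dual ℂ (Fin n → ℂ)} {v : Fin n → ℂ}
    (h : φ v = 1) : substForm φ v (linearPoly φ) = 0 := by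
  rw [substForm_linearPoly, h, C_1, one_mul, sub_self]

theorem dvd_sub_substForm (φ : Module.Dual ℂ (Fin n → ℂ)) (v : Fin n → ℂ) (p : Poly n) :
    linearPoly φ ∣ p - substForm φ v p := by
  induction p using MvPolynomial.induction_on with
  | C a => simp [substForm, algebraMap_eq]
  | add p q hp hq =>
    rw [map_add, add_sub_add_comm]
    exact dvd_add hp hq
  | mul_X p i hp =>
    have hX : substForm φ v (X i) = X i - C (v i) * linearPoly φ := by simp [substForm]
    rw [map_mul, hX, show p * X i - substForm φ v p * (X i - C (v i) * linearPoly φ) =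
      (p - substForm φ v p) * X i + linearPoly φ * (substForm φ v p * C (v i)) by ring]
    exact dvd_add (Dvd.dvd.mul_right hp _) (dvd_mul_right _ _)

/-- If φ(v) = 1, the substitution is an endomorphism of R that kills φ and is the identity modulo φ,
so its kernel is the ideal (φ). As R is a domain, this makes the linear form prime. -/
theorem linearPoly_dvd_iff {φ : Module.Dual ℂ (Fin n → ℂ)} {v : Fin n → ℂ} (h : φ v = 1)
    (p : Poly n) : linearPoly φ ∣ p ↔ substForm φ v p = 0 := by
  constructor
  · rintro ⟨q, rfl⟩
    rw [map_mul, substForm_linearPoly_self h, zero_mul]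
  · intro h0
    simpa [h0] using dvd_sub_substForm φ v p

theorem exists_apply_eq_one {φ : Module.Dual ℂ (Fin n → ℂ)} (hφ : φ ≠ 0) : ∃ v, φ v = 1 := by
  obtain ⟨w, hw⟩ : ∃ w, φ w ≠ 0 := by
    by_contra! h
    exact hφ (LinearMap.ext h)
  exact ⟨(φ w)⁻¹ • w, by simp [hw]⟩

theorem prime_linearPoly {φ : Module.Dual ℂ (Fin n → ℂ)} (hφ : φ ≠ 0) :
    Prime (linearPoly φ) := by
  obtain ⟨v, hv⟩ := exists_apply_eq_one hφ
  refine ⟨linearPoly_ne_zero hφ, fun hu => ?_, fun p q => ?_⟩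
  · have := (linearPoly_dvd_iff hv 1).1 hu.dvd
    simp at this
  · simp only [linearPoly_dvd_iff hv, map_mul, mul_eq_zero]
    exact id

end LinearForms

/-! ### Regular sequences of linear forms. -/

section RegularSequence

variable {n : ℕ} {M : Type*} [AddCommGroup M] [Module (Poly n) M]

/-- A criterion for an element to be regular modulo the first members of a sequence, in terms of
commuting projections killing these members. -/
theorem regular_of_projections (z : ℕ → Poly n) (t : ℕ) (σ : ℕ → M →+ M)
    (hcomm : ∀ a < t, ∀ b < t, a ≠ b → ∀ m, σ a (z b • m) = z b • σ a m)
    (hkill : ∀ a < t, ∀ m, σ a (z a • m) = 0)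
    (hsub : ∀ a < t, ∀ m, ∃ m', m - σ a m = z a • m') (ζ : Poly n)
    (hζ : ∀ a < t, ∀ m, σ a (ζ • m) = ζ • σ a m) (hreg : ∀ m : M, ζ • m = 0 → m = 0) (m : M)
    (hm : ζ • m ∈ initIdeal z t • (⊤ : Submodule (Poly n) M)) :
    m ∈ initIdeal z t • (⊤ : Submodule (Poly n) M) := by
  -- T_s = σ_{s-1} ∘ ⋯ ∘ σ_0 kills I_s M, is the identity modulo I_s M and commutes with ζ. Hence ζ
  -- m ∈ I_t M gives ζ T_t m = 0, so T_t m = 0 and m = m - T_t m ∈ I_t M.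
  let T : ℕ → M →+ M := fun s => Nat.rec (AddMonoidHom.id M) (fun s T => (σ s).comp T) s
  have hT : ∀ s m, T (s + 1) m = σ s (T s m) := fun _ _ => rfl
  have hA : ∀ s ≤ t, ∀ m, m - T s m ∈ initIdeal z s • (⊤ : Submodule (Poly n) M) := by
    intro s
    induction s with
    | zero => intro _ m; simp [T]
    | succ s ih =>
      intro hs m
      obtain ⟨m', hm'⟩ := hsub s (by omega) (T s m)
      refine mem_initIdeal_succ_smul_top.2 ⟨m', ?_⟩
      rw [hT, ← hm']
      convert ih (by omega) m using 1
      abel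
  have hD : ∀ s ≤ t, ∀ b < t, s ≤ b → ∀ m, T s (z b • m) = z b • T s m := by
    intro s
    induction s with
    | zero => intro _ b _ _ m; rfl
    | succ s ih =>
      intro hs b hb hsb m
      rw [hT, ih (by omega) b hb (by omega), hcomm s (by omega) b hb (by omega), hT]
  have hB : ∀ s ≤ t, ∀ m ∈ initIdeal z s • (⊤ : Submodule (Poly n) M), T s m = 0 := by
    intro s
    induction s with
    | zero =>
      intro _ m hm
      rw [initIdeal_zero, Submodule.bot_smul, Submodule.mem_bot] at hm
      rw [hm, map_zero]
    | succ s ih =>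
      intro hs m hm
      obtain ⟨u, hu⟩ := mem_initIdeal_succ_smul_top.1 hm
      have := ih (by omega) _ hu
      rw [map_sub, sub_eq_zero] at this
      rw [hT, this, hD s (by omega) s (by omega) le_rfl, hkill s (by omega)]
  have hC : ∀ s ≤ t, ∀ m, T s (ζ • m) = ζ • T s m := by
    intro s
    induction s with
    | zero => intro _ m; rfl
    | succ s ih =>
      intro hs m
      rw [hT, ih (by omega), hζ s (by omega), hT]
  have h0 := hB t le_rfl _ hm
  rw [hC t le_rfl] at h0
  have := hA t le_rfl m
  rwa [hreg _ h0, sub_zero] at this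

/-- Part of a coordinate system is a regular sequence. -/
theorem linearPoly_regular {N : ℕ} {b : ℕ → Module.Dual ℂ (Fin n → ℂ)} {w : ℕ → Fin n → ℂ}
    (hbw : ∀ a < N, ∀ c < N, b a (w c) = if a = c then 1 else 0) (t : ℕ) (ht : t < N)
    (p : Poly n)
    (hp : linearPoly (b t) * p ∈ initIdeal (fun a => linearPoly (b a)) t) :
    p ∈ initIdeal (fun a => linearPoly (b a)) t := by
  have h := regular_of_projections (M := Poly n) (fun a => linearPoly (b a)) t
    (fun a => (substForm (b a) (w a)).toRingHom.toAddMonoidHom)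
    (fun a ha c hc hac m => by
      have h0 : b c (w a) = 0 := by rw [hbw c (by omega) a (by omega), if_neg hac.symm]
      change substForm (b a) (w a) (linearPoly (b c) * m) = _
      rw [map_mul, substForm_linearPoly_of_eq_zero h0]
      rfl)
    (fun a ha m => by
      have h1 : b a (w a) = 1 := by rw [hbw a (by omega) a (by omega), if_pos rfl]
      change substForm (b a) (w a) (linearPoly (b a) * m) = _
      rw [map_mul, substForm_linearPoly_self h1, zero_mul])
    (fun a ha m => dvd_sub_substForm (b a) (w a) m) (linearPoly (b t))
    (fun a ha m => by
      have h0 : b t (w a) = 0 := by rw [hbw t ht a (by omega), if_neg (by omega)]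
      change substForm (b a) (w a) (linearPoly (b t) * m) = _
      rw [map_mul, substForm_linearPoly_of_eq_zero h0]
      rfl)
    (fun m hm => by
      have hbt : b t ≠ 0 := by
        intro h
        have := hbw t ht t ht
        simp [h] at this
      exact (mul_eq_zero.1 hm).resolve_left (linearPoly_ne_zero hbt))
    p
  simpa using h (by simpa using hp)

theorem initIdeal_linearPoly_eq_maxIdeal {N : ℕ} {b : ℕ → Module.Dual ℂ (Fin n → ℂ)}
    (hb : Submodule.span ℂ (b '' Set.Iio N) = ⊤) :
    initIdeal (fun a => linearPoly (b a)) N = maxIdeal n := by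
  apply le_antisymm
  · rw [initIdeal, Ideal.span_le]
    rintro _ ⟨a, -, rfl⟩
    exact mem_maxIdeal_of_pos one_pos (linearPoly_mem_polyGrading _)
  · rw [maxIdeal, Ideal.span_le]
    rintro _ ⟨i, rfl⟩
    have h : Submodule.span ℂ (b '' Set.Iio N) ≤
        ((initIdeal (fun a => linearPoly (b a)) N).restrictScalars ℂ).comap (linearPolyHom n) := by
      rw [Submodule.span_le]
      rintro _ ⟨a, ha, rfl⟩
      exact mem_initIdeal (fun a => linearPoly (b a)) ha
    rw [hb] at h
    have hi := h (x := LinearMap.proj i) Submodule.mem_top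
    have : linearPolyHom n (LinearMap.proj i) = X i := by
      change linearPoly _ = _
      simp [linearPoly, Pi.single_apply]
    rw [Submodule.mem_comap, this] at hi
    exact hi

end RegularSequence

/-! ### A basis adapted to the arrangement. -/

section AdaptedBasis

variable {n : ℕ}

/-- A basis of the dual space whose last members form a basis of the span of `S` and lie in `S`,
together with the dual vectors. -/
theorem exists_adapted_basis (S : Set (Module.Dual ℂ (Fin n → ℂ))) :
    ∃ (m : ℕ) (b : ℕ → Module.Dual ℂ (Fin n → ℂ)) (w : ℕ → Fin n → ℂ),
      m + Module.finrank ℂ (Submodule.span ℂ S) = n ∧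
      (∀ a < n, ∀ c < n, b a (w c) = if a = c then 1 else 0) ∧
      (∀ a, m ≤ a → a < n → b a ∈ S) ∧ (∀ a < m, ∀ φ ∈ S, φ (w a) = 0) ∧
      Submodule.span ℂ (b '' Set.Iio n) = ⊤ := by
  obtain ⟨B, hBS, hspan, hli⟩ := exists_linearIndependent ℂ S
  have := hli.setFinite.fintype
  rw [← hspan, ← Subtype.range_coe (s := B)]
  let W := Submodule.span ℂ (Set.range ((↑) : B → Module.Dual ℂ (Fin n → ℂ)))
  change ∃ m b w, m + Module.finrank ℂ W = n ∧ _
  let bW := Module.Basis.span hli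
  have hbW : ∀ i, (bW i : Module.Dual ℂ (Fin n → ℂ)) = i :=
    fun i => congrArg Subtype.val (Module.Basis.span_apply hli i)
  have hcard : Fintype.card B = Module.finrank ℂ W := (Module.finrank_eq_card_basis bW).symm
  let e := Fintype.equivFinOfCardEq hcard
  obtain ⟨C, hC⟩ := Submodule.exists_isCompl W
  -- A basis of a complement of W comes first, then elements of S spanning W; the dual vectors of
  -- the first block vanish on W.
  let f := (((Module.finBasis ℂ C).prod (bW.reindex e)).map
    (Submodule.prodEquivOfIsCompl C W hC.symm)).reindex finSumFinEquiv
  have hn : Module.finrank ℂ C + Module.finrank ℂ W = n := by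
    have := Module.finrank_eq_card_basis f
    rw [Subspace.dual_finrank_eq, Module.finrank_fin_fun, Fintype.card_fin] at this
    exact this.symm
  have hfr : ∀ i : Fin (Module.finrank ℂ W), f (Fin.natAdd _ i) = (e.symm i : B) := fun i => by
    simp [f, hbW]
  clear_value f
  generalize Module.finrank ℂ C = m at f hn hfr
  let w : Fin (m + Module.finrank ℂ W) → (Fin n → ℂ) :=
    fun i => (Module.evalEquiv ℂ (Fin n → ℂ)).symm (f.dualBasis i)
  have hw : ∀ i j, f i (w j) = if i = j then 1 else 0 := fun i j => by
    simp only [w, Module.apply_evalEquiv_symm_apply, Module.Basis.dualBasis_apply_self]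
  refine ⟨m, fun a => if h : a < m + Module.finrank ℂ W then f ⟨a, h⟩ else 0,
    fun a => if h : a < m + Module.finrank ℂ W then w ⟨a, h⟩ else 0, hn, ?_, ?_, ?_, ?_⟩
  · intro a ha c hc
    rw [← hn] at ha hc
    simp only [ha, hc, dif_pos, hw, Fin.mk.injEq]
  · intro a hma ha
    rw [← hn] at ha
    simp only [ha, dif_pos]
    obtain ⟨i, hi⟩ : ∃ i : Fin (Module.finrank ℂ W), (⟨a, ha⟩ : Fin _) = Fin.natAdd m i :=
      ⟨⟨a - m, by omega⟩, by ext; simp; omega⟩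
    rw [hi, hfr]
    exact hBS (e.symm i).2
  · intro a ha φ hφ
    have ha' : a < m + Module.finrank ℂ W := by omega
    simp only [ha', dif_pos]
    have hφW : φ ∈ W := by
      change φ ∈ Submodule.span ℂ _
      rw [Subtype.range_coe, hspan]
      exact Submodule.subset_span hφ
    have hle : W ≤ LinearMap.ker (f.dualBasis ⟨a, ha'⟩) := by
      change Submodule.span ℂ _ ≤ _
      rw [Submodule.span_le]
      rintro _ ⟨i, rfl⟩
      have h1 := hfr (e i)
      rw [Equiv.symm_apply_apply] at h1
      rw [SetLike.mem_coe, LinearMap.mem_ker, ← h1, Module.Basis.dualBasis_apply_self, if_neg]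
      rw [Fin.ext_iff]
      simp; omega
    have := hle hφW
    rw [LinearMap.mem_ker] at this
    simp only [w, Module.apply_evalEquiv_symm_apply, this]
  · rw [eq_top_iff, ← f.span_eq, Submodule.span_le]
    rintro _ ⟨i, rfl⟩
    refine Submodule.subset_span ⟨i, ?_, ?_⟩
    · have := i.2
      rw [Set.mem_Iio]; omega
    · simp

end AdaptedBasis

/-! ### Logarithmic derivations and their depth. -/

section LogDer

variable {n : ℕ} {ι : Type*} (φ : ι → Module.Dual ℂ (Fin n → ℂ))

/-- The module of logarithmic derivations along the hyperplanes `φ i = 0`, `i ∈ s`. -/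
def logDer (s : Finset ι) : Submodule (Poly n) (Fin n → Poly n) where
  carrier := {θ | ∀ i ∈ s, linearPoly (φ i) ∣ dotForm (φ i) θ}
  add_mem' h h' i hi := by rw [map_add]; exact dvd_add (h i hi) (h' i hi)
  zero_mem' i _ := by rw [map_zero]; exact dvd_zero _
  smul_mem' p θ h i hi := by rw [map_smul]; exact Dvd.dvd.mul_left (h i hi) p

variable {φ}

theorem logDer_mono {s t : Finset ι} (h : s ⊆ t) : logDer φ t ≤ logDer φ s :=
  fun _ hθ i hi => hθ i (h hi)

theorem smul_mem_logDer [DecidableEq ι] {s : Finset ι} {i : ι} {θ : Fin n → Poly n}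
    (hθ : θ ∈ logDer φ (s.erase i)) : linearPoly (φ i) • θ ∈ logDer φ s := by
  intro k hk
  rcases eq_or_ne k i with rfl | hne
  · rw [map_smul]; exact dvd_mul_right _ _
  · exact (logDer φ (s.erase i)).smul_mem _ hθ k (Finset.mem_erase.2 ⟨hne, hk⟩)

theorem dotForm_graded (ψ : Module.Dual ℂ (Fin n → ℂ)) (k : ℤ) (θ : Fin n → Poly n)
    (hθ : θ ∈ freeGrading (fun _ => 0) k) : dotForm ψ θ ∈ polyGrading n k := by
  rw [dotForm_apply]
  refine Submodule.sum_mem _ fun i _ => ?_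
  have := polyGrading_mul (C_mem_polyGrading (ψ (Pi.single i 1))) (mem_freeGrading.1 hθ i)
  rwa [zero_add, sub_zero] at this

theorem dvd_polyProj {p : Poly n} {a : ℤ} (hp : p ∈ polyGrading n a) (k : ℤ) {q : Poly n}
    (h : p ∣ q) : p ∣ polyProj n k q := by
  obtain ⟨u, rfl⟩ := h
  have := (polyProj_gradedProj n).map_proj (polyProj_gradedProj n) (a := a)
    (AddMonoidHom.mulLeft p) (fun k m hm => by
      have := polyGrading_mul hp hm
      rwa [add_comm] at this) (k - a) u
  simp only [AddMonoidHom.coe_mulLeft, sub_add_cancel] at this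
  rw [← this]
  exact dvd_mul_right _ _

theorem logDer_stable (s : Finset ι) (k : ℤ) (θ : Fin n → Poly n) (hθ : θ ∈ logDer φ s) :
    freeProj (fun _ => 0) k θ ∈ logDer φ s := fun i hi => by
  have := (freeProj_gradedProj (fun _ : Fin n => (0 : ℤ))).map_proj (polyProj_gradedProj n)
    (a := 0) (dotForm (φ i)).toAddMonoidHom
    (fun k m hm => by simpa using dotForm_graded (φ i) k m hm) k θ
  simp only [LinearMap.toAddMonoidHom_coe] at this
  rw [this]
  exact dvd_polyProj (linearPoly_mem_polyGrading _) _ (hθ i hi)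

variable (φ) in
/-- The grading of the module of logarithmic derivations by polynomial degree. -/
def logDerGrading (s : Finset ι) : ℤ → Submodule ℂ (logDer φ s) :=
  subGrading (freeGrading (n := n) (fun _ => 0)) (logDer φ s)

theorem logDer_isGradedModule (s : Finset ι) : IsGradedModule n (logDerGrading φ s) :=
  subGrading_isGradedModule (freeGrading_isGradedModule _) (freeProj_gradedProj _) _
    (logDer_stable s)

theorem dotForm_map_substForm (ψ χ : Module.Dual ℂ (Fin n → ℂ)) (v : Fin n → ℂ)
    (θ : Fin n → Poly n) :
    dotForm ψ (fun i => substForm χ v (θ i)) = substForm χ v (dotForm ψ θ) := by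
  simp [dotForm_apply, map_sum, substForm, algebraMap_eq]

/-- The substitution along a vector in all the hyperplanes acts on logarithmic derivations. -/
def logDerSubst (s : Finset ι) (χ : Module.Dual ℂ (Fin n → ℂ)) (v : Fin n → ℂ)
    (hv : ∀ i ∈ s, φ i v = 0) : logDer φ s →+ logDer φ s where
  toFun θ := ⟨fun i => substForm χ v (θ.1 i), fun i hi => by
    rw [dotForm_map_substForm, ← substForm_linearPoly_of_eq_zero (φ := χ) (hv i hi)]
    exact map_dvd _ (θ.2 i hi)⟩
  map_zero' := Subtype.ext (funext fun i => map_zero _)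
  map_add' θ η := Subtype.ext (funext fun i => map_add _ _ _)

theorem logDerSubst_smul (s : Finset ι) (χ : Module.Dual ℂ (Fin n → ℂ)) (v : Fin n → ℂ)
    (hv : ∀ i ∈ s, φ i v = 0) (p : Poly n) (θ : logDer φ s) :
    logDerSubst s χ v hv (p • θ) = substForm χ v p • logDerSubst s χ v hv θ :=
  Subtype.ext (funext fun _ => map_mul _ _ _)

/-- The quotient η by χ exists coordinatewise. It is logarithmic because v lies in every hyperplane:
the substitution fixes φ_i, so with φ_i(θ) = φ_i q one gets χ φ_i(η) = φ_i (q - subst q), a multiple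
of φ_i χ, and χ cancels. -/
theorem exists_sub_logDerSubst (s : Finset ι) (χ : Module.Dual ℂ (Fin n → ℂ)) (v : Fin n → ℂ)
    (hχ : χ ≠ 0) (hv : ∀ i ∈ s, φ i v = 0) (θ : logDer φ s) :
    ∃ θ', θ - logDerSubst s χ v hv θ = linearPoly χ • θ' := by
  choose η hη using fun i => dvd_sub_substForm χ v (θ.1 i)
  have hθη : θ.1 - (logDerSubst s χ v hv θ).1 = linearPoly χ • η := funext hη
  refine ⟨⟨η, fun i hi => ?_⟩, Subtype.ext hθη⟩
  obtain ⟨q, hq⟩ := θ.2 i hi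
  obtain ⟨q', hq'⟩ := dvd_sub_substForm χ v q
  refine ⟨q', mul_left_cancel₀ (linearPoly_ne_zero hχ) ?_⟩
  have h1 : linearPoly χ * dotForm (φ i) η = dotForm (φ i) θ.1 -
      substForm χ v (dotForm (φ i) θ.1) := by
    rw [← smul_eq_mul, ← map_smul, ← hθη, map_sub, ← dotForm_map_substForm]
    rfl
  rw [h1, hq, map_mul, substForm_linearPoly_of_eq_zero (hv i hi), ← mul_sub, hq']
  ring

/-- Coordinates along the intersection of the hyperplanes, followed by one more linear form, are
a regular sequence on the module of logarithmic derivations. -/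
theorem logDer_regular (s : Finset ι) {m : ℕ} {b : ℕ → Module.Dual ℂ (Fin n → ℂ)}
    {w : ℕ → Fin n → ℂ} (hm : m < n)
    (hbw : ∀ a < n, ∀ c < n, b a (w c) = if a = c then 1 else 0)
    (hw : ∀ a < m, ∀ i ∈ s, φ i (w a) = 0) (t : ℕ) (ht : t < m + 1) (θ : logDer φ s)
    (hθ : linearPoly (b t) • θ ∈ initIdeal (fun a => linearPoly (b a)) t •
      (⊤ : Submodule (Poly n) (logDer φ s))) :
    θ ∈ initIdeal (fun a => linearPoly (b a)) t • (⊤ : Submodule (Poly n) (logDer φ s)) := by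
  have hb0 : ∀ a < n, b a ≠ 0 := fun a ha h => by
    have := hbw a ha a ha
    simp [h] at this
  have hcomm : ∀ a < n, ∀ c < n, a ≠ c →
      substForm (b a) (w a) (linearPoly (b c)) = linearPoly (b c) := fun a ha c hc hac => by
    rw [substForm_linearPoly_of_eq_zero]
    rw [hbw c hc a ha, if_neg hac.symm]
  -- Only indices a < t ≤ m require a projection, so the default value 0 is never used; the form at
  -- t = m need only be a nonzerodivisor on a torsion-free module.
  let σ : ℕ → logDer φ s →+ logDer φ s := fun a =>
    if h : a < m then logDerSubst s (b a) (w a) (hw a h) else 0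
  have hσ : ∀ a (h : a < m), σ a = logDerSubst s (b a) (w a) (hw a h) := fun a h => dif_pos h
  refine regular_of_projections (fun a => linearPoly (b a)) t σ ?_ ?_ ?_ (linearPoly (b t)) ?_ ?_
    θ hθ
  · intro a ha c hc hac θ
    rw [hσ a (by omega), logDerSubst_smul, hcomm a (by omega) c (by omega) hac]
  · intro a ha θ
    rw [hσ a (by omega), logDerSubst_smul, substForm_linearPoly_self, zero_smul]
    rw [hbw a (by omega) a (by omega), if_pos rfl]
  · intro a ha θ
    rw [hσ a (by omega)]
    exact exists_sub_logDerSubst s _ _ (hb0 a (by omega)) _ θ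
  · intro a ha θ
    rw [hσ a (by omega), logDerSubst_smul, hcomm a (by omega) t (by omega) (by omega)]
  · intro θ h
    exact (smul_eq_zero.1 h).resolve_left (linearPoly_ne_zero (hb0 t (by omega)))

end LogDer

/-! ### Resolutions of free modules and of M ⊕ R(-a). -/

section FreeResolution

variable {n : ℕ}

/-- The trivial resolution of a graded free module. -/
def GradedFreeResolution.ofFree {r : ℕ} (c : Fin r → ℤ) :
    GradedFreeResolution (n := n) (freeGrading (n := n) c) where
  rank := fun | 0 => r | _ + 1 => 0
  c := fun | 0 => c | _ + 1 => 0
  diff _ := 0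
  aug := LinearMap.id
  diff_graded _ _ _ _ := zero_mem _
  aug_graded _ _ hv := hv
  aug_surjective := Function.surjective_id
  exact_zero v := by
    constructor
    · intro h; exact ⟨0, h.symm⟩
    · rintro ⟨w, rfl⟩; rfl
  exact_succ _ v := by
    constructor
    · intro _; exact ⟨0, Subsingleton.elim _ _⟩
    · intro _; rfl

/-- `v ↦ (0, v)`. -/
def consZero (n r : ℕ) : (Fin r → Poly n) →ₗ[Poly n] (Fin (r + 1) → Poly n) where
  toFun v := Fin.cons 0 v
  map_add' v w := by
    ext1 i
    refine Fin.cases ?_ (fun i => ?_) i <;> simp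
  map_smul' p v := by
    ext1 i
    refine Fin.cases ?_ (fun i => ?_) i <;> simp

variable {M : Type*} [AddCommGroup M] [Module ℂ M] [Module (Poly n) M]
  {ℳ : ℤ → Submodule ℂ M}

/-- The grading of `M ⊕ R(-a)`. -/
def prodGrading (ℳ : ℤ → Submodule ℂ M) (a k : ℤ) : Submodule ℂ (M × Poly n) :=
  (ℳ k).prod (polyGrading n (k - a))

theorem GradedProj.eq_sum_of_subset {π : ℤ → M →ₗ[ℂ] M} (hπ : GradedProj ℳ π) {m : M}
    {s t : Finset ℤ} (hs : m = ∑ k ∈ s, π k m) (hst : s ⊆ t) : m = ∑ k ∈ t, π k m := by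
  rw [← Finset.sum_subset hst, ← hs]
  intro l _ hl
  rw [hs, map_sum]
  refine Finset.sum_eq_zero fun k hk => hπ.ne k l ?_ _ (hπ.mem k m)
  rintro rfl
  exact hl hk

theorem prodGrading_isGradedModule (hℳ : IsGradedModule n ℳ) (a : ℤ) :
    IsGradedModule n (prodGrading (n := n) ℳ a) where
  smul_mem b k p hp x hx := by
    refine ⟨hℳ.smul_mem b k p hp _ hx.1, ?_⟩
    have := polyGrading_mul hp hx.2
    rwa [← add_sub_assoc] at this
  exists_proj := by
    obtain ⟨π, hπ⟩ := hℳ.exists_proj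
    have hρ := polyProj_gradedProj n
    refine ⟨fun k => (π k).prodMap (polyProj n (k - a)), fun k x => ⟨hπ.mem _ _, hρ.mem _ _⟩,
      fun k x hx => Prod.ext (hπ.self _ _ hx.1) (hρ.self _ _ hx.2),
      fun k l hkl x hx => Prod.ext (hπ.ne _ _ hkl _ hx.1) (hρ.ne _ _ (by omega) _ hx.2),
      fun x => ?_⟩
    obtain ⟨s, hs⟩ := hπ.exists_sum x.1
    obtain ⟨t, ht⟩ := hρ.exists_sum x.2
    refine ⟨s ∪ t.image (fun k => k + a), Prod.ext ?_ ?_⟩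
    · rw [Prod.fst_sum]
      exact hπ.eq_sum_of_subset hs Finset.subset_union_left
    · rw [Prod.snd_sum]
      have := hρ.eq_sum_of_subset ht
        (t := (s ∪ t.image (fun k => k + a)).image (fun k => k - a)) (by
          intro k hk
          refine Finset.mem_image.2 ⟨k + a, Finset.mem_union_right _
            (Finset.mem_image_of_mem _ hk), by ring⟩)
      rwa [Finset.sum_image (by intro x _ y _ h; simpa using h)] at this

/-- The resolution of `M ⊕ R(-a)` given by a resolution of `M`. -/
def GradedFreeResolution.consFree (G : GradedFreeResolution (n := n) ℳ) (a : ℤ) :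
    GradedFreeResolution (n := n) (prodGrading (n := n) ℳ a) where
  rank := fun | 0 => G.rank 0 + 1 | j + 1 => G.rank (j + 1)
  c := fun | 0 => Fin.cons a (G.c 0) | j + 1 => G.c (j + 1)
  diff := fun | 0 => consZero n (G.rank 0) ∘ₗ G.diff 0 | j + 1 => G.diff (j + 1)
  aug := (G.aug ∘ₗ LinearMap.funLeft (Poly n) (Poly n) Fin.succ).prod (LinearMap.proj 0)
  diff_graded := fun
    | 0 => fun k v hv => mem_freeGrading.2 fun i => by
        have := mem_freeGrading.1 (G.diff_graded 0 k v hv)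
        refine Fin.cases ?_ (fun i => ?_) i
        · exact zero_mem _
        · exact this i
    | j + 1 => G.diff_graded (j + 1)
  aug_graded k v hv := by
    have := mem_freeGrading.1 hv
    exact ⟨G.aug_graded k _ (mem_freeGrading.2 fun i => this i.succ), this 0⟩
  aug_surjective := by
    rintro ⟨m, p⟩
    obtain ⟨v, rfl⟩ := G.aug_surjective m
    exact ⟨Fin.cons p v, rfl⟩
  exact_zero v := by
    constructor
    · intro h
      have h1 : G.aug (fun i => v i.succ) = 0 := congrArg Prod.fst h
      have h2 : v 0 = 0 := congrArg Prod.snd h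
      obtain ⟨w, hw⟩ := (G.exact_zero _).1 h1
      refine ⟨w, funext fun i => ?_⟩
      refine Fin.cases ?_ (fun i => ?_) i
      · exact h2.symm
      · exact congrFun hw i
    · rintro ⟨w, rfl⟩
      exact Prod.ext (G.aug_diff w) rfl
  exact_succ := fun
    | 0 => fun v => by
        rw [← G.exact_succ 0 v]
        constructor
        · intro h
          exact funext fun i => congrFun h i.succ
        · intro h
          change consZero n _ (G.diff 0 v) = 0
          rw [h, map_zero]
    | j + 1 => G.exact_succ (j + 1)

end FreeResolution

/-! ### The regularity bound by deletion of hyperplanes. -/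

section Induction

variable {n : ℕ} {ι : Type*} {φ : ι → Module.Dual ℂ (Fin n → ℂ)}

instance (s : Finset ι) : Module.Finite (Poly n) (logDer φ s) :=
  Module.Finite.of_fg (IsNoetherian.noetherian _)

/-- The module of logarithmic derivations has a minimal resolution whose degrees are bounded by
`b`. -/
def LogDerBound (φ : ι → Module.Dual ℂ (Fin n → ℂ)) (s : Finset ι) (b : ℤ) : Prop :=
  ∃ F : MinimalGradedFreeResolution (n := n) (logDerGrading φ s), ∀ j k, F.c j k ≤ b + j

/-- With no hyperplanes the module is all of R^n, free on generators of degree 0. -/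
theorem logDerBound_empty {b : ℤ} (hb : 0 ≤ b) : LogDerBound φ ∅ b := by
  obtain ⟨F⟩ := nonempty_minimalGradedFreeResolution (logDer_isGradedModule (φ := φ) ∅)
  refine ⟨F, fun j k => ?_⟩
  obtain ⟨l, hl⟩ := F.exists_degree_le_of_retract (GradedFreeResolution.ofFree (fun _ => 0))
    (logDer_isGradedModule ∅) (freeGrading_isGradedModule _) (logDer φ ∅).subtype
    (fun _ _ hm => hm)
    (LinearMap.codRestrict (logDer φ ∅) LinearMap.id (fun _ i hi => absurd hi (by simp)))
    (fun _ _ hm => hm) (fun _ => rfl) j k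
  cases j with
  | zero => exact hl.trans (by simpa [GradedFreeResolution.ofFree] using hb)
  | succ j => exact l.elim0

/-- Division by a nonzero polynomial, on its multiples. -/
theorem exists_linear_quotient {M : Type*} [AddCommGroup M] [Module (Poly n) M]
    (T : M →ₗ[Poly n] Poly n) {f : Poly n} (hf : f ≠ 0) (h : ∀ m, f ∣ T m) :
    ∃ Q : M →ₗ[Poly n] Poly n, ∀ m, f * Q m = T m := by
  choose q hq using h
  refine ⟨{ toFun := q, map_add' := fun x y => ?_, map_smul' := fun p x => ?_ },
    fun m => (hq m).symm⟩
  · apply mul_left_cancel₀ hf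
    rw [← hq, map_add, hq x, hq y, mul_add]
  · apply mul_left_cancel₀ hf
    rw [← hq, map_smul, hq x]
    simp only [smul_eq_mul, RingHom.id_apply]
    ring

theorem mem_polyGrading_of_mul {f q : Poly n} {a b : ℤ} (hf : f ≠ 0) (hfa : f ∈ polyGrading n a)
    (h : f * q ∈ polyGrading n (b + a)) : q ∈ polyGrading n b := by
  have := (polyProj_gradedProj n).map_proj (polyProj_gradedProj n) (a := a)
    (AddMonoidHom.mulLeft f) (fun k m hm => by
      have := polyGrading_mul hfa hm
      rwa [add_comm] at this) b q
  simp only [AddMonoidHom.coe_mulLeft] at this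
  rw [(polyProj_gradedProj n).self _ _ h] at this
  rw [← mul_left_cancel₀ hf this]
  exact (polyProj_gradedProj n).mem _ _

variable [DecidableEq ι]

/-- Adding a hyperplane in general position to all the others. -/
theorem LogDerBound.of_erase_coloop {s : Finset ι} {i : ι} {b : ℤ}
    (h : LogDerBound φ (s.erase i) b) (hb : 1 ≤ b) (hi : i ∈ s) {v : Fin n → ℂ}
    (hvi : φ i v = 1) (hv : ∀ k ∈ s.erase i, φ k v = 0) : LogDerBound φ s b := by
  obtain ⟨G, hG⟩ := h
  obtain ⟨F⟩ := nonempty_minimalGradedFreeResolution (logDer_isGradedModule (φ := φ) s)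
  refine ⟨F, fun j k => ?_⟩
  have hφi : φ i ≠ 0 := by
    intro h
    rw [h] at hvi
    simp at hvi
  obtain ⟨Q, hQ⟩ := exists_linear_quotient (dotForm (φ i) ∘ₗ (logDer φ s).subtype)
    (linearPoly_ne_zero hφi) (fun θ => θ.2 i hi)
  -- the constant derivation along `v`
  let e : Fin n → Poly n := fun k => C (v k)
  have he : ∀ ψ : Module.Dual ℂ (Fin n → ℂ), dotForm ψ e = C (ψ v) := fun ψ => by
    rw [dotForm_apply, dual_apply_eq_sum ψ v, map_sum]
    simp [e]
  have heg : ∀ k, ∀ p ∈ polyGrading n k, p • e ∈ freeGrading (fun _ => 0) k := fun k p hp =>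
    mem_freeGrading.2 fun l => by
      have := polyGrading_mul hp (C_mem_polyGrading (v l))
      rwa [add_zero, ← sub_zero k] at this
  -- The map (η, q) ↦ η - φ_i(η) e + φ_i q e is a retraction of θ ↦ (θ, φ_i(θ)/φ_i), on whose image
  -- the two corrections cancel. The result is logarithmic along φ_i since its value there is φ_i q,
  -- and along the others since they vanish on v.
  let Ψ : (logDer φ (s.erase i) × Poly n) →ₗ[Poly n] (Fin n → Poly n) :=
    LinearMap.coprod ((logDer φ (s.erase i)).subtype -
        (dotForm (φ i) ∘ₗ (logDer φ (s.erase i)).subtype).smulRight e)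
      ((linearPoly (φ i) • LinearMap.id).smulRight e)
  have hΨ : ∀ x, Ψ x = x.1.1 - dotForm (φ i) x.1.1 • e + (linearPoly (φ i) * x.2) • e :=
    fun x => rfl
  have hΨmem : ∀ x, Ψ x ∈ logDer φ s := fun x k hk => by
    rw [hΨ, map_add, map_sub, map_smul, map_smul, he]
    rcases eq_or_ne k i with rfl | hne
    · rw [hvi]
      simp
    · have hk' := Finset.mem_erase.2 ⟨hne, hk⟩
      rw [hv k hk']
      simpa using x.1.2 k hk'
  obtain ⟨l, hl⟩ := F.exists_degree_le_of_retract (G.toGraded.consFree 1)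
    (logDer_isGradedModule s) (prodGrading_isGradedModule (logDer_isGradedModule _) 1)
    ((Submodule.inclusion (logDer_mono (Finset.erase_subset i s))).prod Q)
    (fun k θ hθ => ⟨hθ, by
      refine mem_polyGrading_of_mul (linearPoly_ne_zero hφi) (linearPoly_mem_polyGrading (φ i)) ?_
      change linearPoly (φ i) * Q θ ∈ _
      rw [hQ, sub_add_cancel]
      exact dotForm_graded (φ i) k _ hθ⟩)
    (LinearMap.codRestrict _ Ψ hΨmem)
    (fun k x hx => by
      change Ψ x ∈ freeGrading (fun _ => 0) k
      rw [hΨ]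
      refine add_mem (sub_mem hx.1 (heg _ _ (dotForm_graded (φ i) k _ hx.1))) (heg _ _ ?_)
      have := polyGrading_mul (linearPoly_mem_polyGrading (φ i)) hx.2
      rwa [add_sub_cancel] at this)
    (fun θ => Subtype.ext (by
      change Ψ (_, Q θ) = _
      rw [hΨ, hQ]
      exact sub_add_cancel _ _)) j k
  refine hl.trans ?_
  cases j with
  | zero =>
    revert l
    refine Fin.cases ?_ (fun l => ?_)
    · intro _; simpa [GradedFreeResolution.consFree] using hb
    · intro _; exact hG 0 l
  | succ j => exact hG (j + 1) l

/-- Adding a hyperplane without changing the rank, through the approximation theorem. -/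
theorem LogDerBound.of_erase {s : Finset ι} (hs : s.Nonempty) (hφ : ∀ i ∈ s, φ i ≠ 0) {r : ℤ}
    (h : ∀ i ∈ s, LogDerBound φ (s.erase i) r) : LogDerBound φ s (r + 1) := by
  obtain ⟨F⟩ := nonempty_minimalGradedFreeResolution (logDer_isGradedModule (φ := φ) s)
  refine ⟨F, ?_⟩
  obtain ⟨m, b, w, hmn, hbw, hbS, hw, hspan⟩ := exists_adapted_basis (φ '' (s : Set ι))
  set ρ := Module.finrank ℂ (Submodule.span ℂ (φ '' (s : Set ι))) with hρ
  have hρ0 : 0 < ρ := by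
    obtain ⟨i, hi⟩ := hs
    rw [hρ, Module.finrank_pos_iff]
    refine ⟨⟨⟨φ i, Submodule.subset_span ⟨i, hi, rfl⟩⟩, 0, fun h0 => hφ i hi ?_⟩⟩
    exact congrArg Subtype.val h0
  -- This gives m + 1 regular forms, so F_j = 0 for j ≥ n - m = ρ, which is exactly the number of
  -- basis forms chosen from the arrangement.
  have hreg := logDer_regular s (by omega) hbw (fun a ha i hi => hw a ha _ ⟨i, hi, rfl⟩)
  have hlen : ∀ j, ρ ≤ j → F.rank j = 0 := fun j hj => by
    cases j with
    | zero => omega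
    | succ j =>
      exact F.rank_eq_zero_of_regular (initIdeal_linearPoly_eq_maxIdeal hspan)
        (linearPoly_regular hbw) hreg j (by omega)
  refine F.degree_le_of_lowNullhomotopic (z := fun t => linearPoly (b (m + t))) hlen ?_ ?_
  · exact fun t ht p hp => linearPoly_regular (N := ρ) (b := fun t => b (m + t))
      (w := fun t => w (m + t))
      (fun a ha c hc => by
        rw [hbw _ (by omega) _ (by omega)]
        simp) t ht p hp
  · intro t ht
    -- Each form of the sequence is some φ_i; multiplication by it is the inclusion into the module
    -- of the deletion of i followed by multiplication back.
    obtain ⟨i, hi, hbi⟩ := hbS (m + t) (by omega) (by omega)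
    obtain ⟨G, hG⟩ := h i hi
    rw [← hbi]
    exact F.lowNullhomotopic_of_factor G.toGraded (logDer_isGradedModule s)
      (logDer_isGradedModule _) (linearPoly_mem_polyGrading _)
      (Submodule.inclusion (logDer_mono (Finset.erase_subset i s))) (fun _ _ hm => hm)
      (LinearMap.codRestrict (logDer φ s)
        ((linearPoly (φ i) • LinearMap.id) ∘ₗ (logDer φ (s.erase i)).subtype)
        (fun θ => smul_mem_logDer θ.2))
      (fun k θ hθ => by
        have := (freeGrading_isGradedModule (fun _ : Fin n => (0 : ℤ))).smul_mem 1 k _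
          (linearPoly_mem_polyGrading (φ i)) _ hθ
        rwa [add_comm] at this)
      (fun _ => rfl) hG

/-- A functional on the dual space separating ψ from the span is, by reflexivity, evaluation at a
vector. -/
theorem exists_vector_of_notMem_span {S : Set (Module.Dual ℂ (Fin n → ℂ))}
    {ψ : Module.Dual ℂ (Fin n → ℂ)} (hψ : ψ ∉ Submodule.span ℂ S) :
    ∃ v, ψ v = 1 ∧ ∀ χ ∈ S, χ v = 0 := by
  obtain ⟨f, hf, hf0⟩ := Submodule.exists_dual_map_eq_bot_of_notMem hψ inferInstance
  refine ⟨(f ψ)⁻¹ • (Module.evalEquiv ℂ (Fin n → ℂ)).symm f, ?_, fun χ hχ => ?_⟩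
  · rw [map_smul, Module.apply_evalEquiv_symm_apply, smul_eq_mul, inv_mul_cancel₀ hf]
  · have : f χ ∈ Submodule.map f (Submodule.span ℂ S) :=
      Submodule.mem_map_of_mem (Submodule.subset_span hχ)
    rw [hf0, Submodule.mem_bot] at this
    rw [map_smul, Module.apply_evalEquiv_symm_apply, this, smul_zero]

/-- The regularity of the module of logarithmic derivations of an arrangement is at most its
number of hyperplanes minus its rank plus one. -/
theorem logDerBound (φ : ι → Module.Dual ℂ (Fin n → ℂ)) (s : Finset ι) (hφ : ∀ i ∈ s, φ i ≠ 0) :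
    LogDerBound φ s
      (s.card - Module.finrank ℂ (Submodule.span ℂ (φ '' (s : Set ι))) + 1 : ℤ) := by
  induction s using Finset.strongInduction with
  | H s ih =>
  have hle : Module.finrank ℂ (Submodule.span ℂ (φ '' (s : Set ι))) ≤ s.card := by
    classical
    rw [← Finset.coe_image]
    exact (finrank_span_finset_le_card _).trans Finset.card_image_le
  have ih' : ∀ i ∈ s, _ := fun i hi => ih (s.erase i) (Finset.erase_ssubset hi)
    fun k hk => hφ k (Finset.mem_of_mem_erase hk)
  have hins : ∀ i ∈ s, (s : Set ι) = insert i ((s.erase i : Finset ι) : Set ι) := fun i hi => by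
    rw [← Finset.coe_insert, Finset.insert_erase hi]
  rcases s.eq_empty_or_nonempty with rfl | hne
  · exact logDerBound_empty (by omega)
  -- The approximation step needs a common bound for all deletions, so any coloop is removed first.
  -- Deleting a coloop lowers the cardinality by one and the rank by at most one, so the bound does
  -- not grow; it is at least 1 because rank ≤ cardinality.
  by_cases hcol : ∃ i ∈ s, φ i ∉ Submodule.span ℂ (φ '' ((s.erase i : Finset ι) : Set ι))
  · obtain ⟨i, hi, hspan⟩ := hcol
    obtain ⟨v, hvi, hv⟩ := exists_vector_of_notMem_span hspan
    have hr : Module.finrank ℂ (Submodule.span ℂ (φ '' (s : Set ι))) ≤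
        Module.finrank ℂ (Submodule.span ℂ (φ '' ((s.erase i : Finset ι) : Set ι))) + 1 := by
      rw [hins i hi, Set.image_insert_eq, Submodule.span_insert, add_comm]
      refine (Submodule.finrank_add_le_finrank_add_finrank _ _).trans ?_
      rw [finrank_span_singleton (hφ i hi)]
    have hc := Finset.card_erase_add_one hi
    obtain ⟨G, hG⟩ := ih' i hi
    refine LogDerBound.of_erase_coloop (i := i) ⟨G, fun j k => (hG j k).trans ?_⟩ (by omega) hi hvi
      (fun k hk => hv _ ⟨k, hk, rfl⟩)
    omega
  -- No deletion changes the rank, so the bound for each deletion is one less.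
  · push Not at hcol
    refine LogDerBound.of_erase hne hφ fun i hi => ?_
    have hc := Finset.card_erase_add_one hi
    have hr : Submodule.span ℂ (φ '' (s : Set ι)) =
        Submodule.span ℂ (φ '' ((s.erase i : Finset ι) : Set ι)) := by
      rw [hins i hi, Set.image_insert_eq, Submodule.span_insert_eq_span (hcol i hi)]
    obtain ⟨G, hG⟩ := ih' i hi
    refine ⟨G, fun j k => (hG j k).trans ?_⟩
    rw [hr]
    omega

end Induction

/-! ### Shifting, splicing and quotients. -/

section Constructions

variable {n : ℕ} {M : Type*} [AddCommGroup M] [Module ℂ M] [Module (Poly n) M]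
  {ℳ : ℤ → Submodule ℂ M}

theorem mem_freeGrading_add {r : ℕ} {c : Fin r → ℤ} {e k : ℤ} {v : Fin r → Poly n} :
    v ∈ freeGrading (fun i => c i + e) k ↔ v ∈ freeGrading c (-e + k) := by
  simp only [mem_freeGrading]
  refine forall_congr' fun i => ?_
  rw [show k - (c i + e) = -e + k - c i by ring]

/-- The resolution of a shifted module. -/
def GradedFreeResolution.shift (G : GradedFreeResolution (n := n) ℳ) (e : ℤ) :
    GradedFreeResolution (n := n) (shift ℳ (-e)) where
  rank := G.rank
  c j i := G.c j i + e
  diff := G.diff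
  aug := G.aug
  diff_graded j _ v hv :=
    mem_freeGrading_add.2 (G.diff_graded j _ v (mem_freeGrading_add.1 hv))
  aug_graded _ v hv := G.aug_graded _ v (mem_freeGrading_add.1 hv)
  aug_surjective := G.aug_surjective
  exact_zero := G.exact_zero
  exact_succ := G.exact_succ

/-- A resolution from a graded free cover and a resolution of its kernel. -/
def GradedFreeResolution.splice {r : ℕ} {c : Fin r → ℤ} {p : (Fin r → Poly n) →ₗ[Poly n] M}
    (hp : ∀ k, ∀ v ∈ freeGrading c k, p v ∈ ℳ k) (hsurj : Function.Surjective p)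
    (G : GradedFreeResolution (n := n) (subGrading (freeGrading (n := n) c) (LinearMap.ker p))) :
    GradedFreeResolution (n := n) ℳ where
  rank := fun | 0 => r | j + 1 => G.rank j
  c := fun | 0 => c | j + 1 => G.c j
  diff := fun | 0 => (LinearMap.ker p).subtype ∘ₗ G.aug | j + 1 => G.diff j
  aug := p
  diff_graded := fun | 0 => G.aug_graded | j + 1 => G.diff_graded j
  aug_graded := hp
  aug_surjective := hsurj
  exact_zero v := by
    constructor
    · intro h
      obtain ⟨w, hw⟩ := G.aug_surjective ⟨v, h⟩
      exact ⟨w, congrArg Subtype.val hw⟩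
    · rintro ⟨w, rfl⟩
      exact (G.aug w).2
  exact_succ := fun
    | 0 => fun v => by
        rw [← G.exact_zero v]
        exact ⟨fun h => Subtype.ext h, fun h => congrArg Subtype.val h⟩
    | j + 1 => G.exact_succ j

/-- The image of a graded module under a map with graded kernel. -/
theorem IsGradedModule.map_of_surjective {N : Type*} [AddCommGroup N] [Module ℂ N]
    [Module (Poly n) N] (hℳ : IsGradedModule n ℳ) {π : ℤ → M →ₗ[ℂ] M} (hπ : GradedProj ℳ π)
    (q : M →ₗ[ℂ] N) (hq : Function.Surjective q) (hsmul : ∀ (p : Poly n) m, q (p • m) = p • q m)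
    (hker : ∀ k m, q m = 0 → q (π k m) = 0) :
    IsGradedModule n (fun k => (ℳ k).map q) where
  smul_mem a b p hp := by
    rintro _ ⟨m, hm, rfl⟩
    exact ⟨p • m, hℳ.smul_mem a b p hp m hm, hsmul p m⟩
  exists_proj := by
    let ρ : ℤ → N →ₗ[ℂ] N := fun k =>
      (LinearMap.ker q).liftQ (q ∘ₗ π k) (fun m hm => hker k m hm) ∘ₗ
        (q.quotKerEquivOfSurjective hq).symm.toLinearMap
    have hρ : ∀ k m, ρ k (q m) = q (π k m) := fun k m => by
      have : (q.quotKerEquivOfSurjective hq).symm (q m) = Submodule.Quotient.mk m := by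
        rw [LinearEquiv.symm_apply_eq]
        rfl
      simp only [ρ, LinearMap.comp_apply, LinearEquiv.coe_coe]
      rw [this]
      rfl
    refine ⟨ρ, fun k x => ?_, ?_, ?_, fun x => ?_⟩
    · obtain ⟨m, rfl⟩ := hq x
      rw [hρ]
      exact Submodule.mem_map_of_mem (hπ.mem k m)
    · rintro k _ ⟨m, hm, rfl⟩
      rw [hρ, hπ.self k m hm]
    · rintro k l hkl _ ⟨m, hm, rfl⟩
      rw [hρ, hπ.ne k l hkl m hm, map_zero]
    · obtain ⟨m, rfl⟩ := hq x
      obtain ⟨s, hs⟩ := hπ.exists_sum m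
      refine ⟨s, ?_⟩
      simp only [hρ]
      rw [← map_sum, ← hs]

end Constructions

/-! ### Partial derivatives and logarithmic derivations. -/

section Jacobian

variable {n : ℕ}

/-- The derivative of `p` along a vector field `θ`, as a linear function of `θ`. -/
def jacForm (p : Poly n) : (Fin n → Poly n) →ₗ[Poly n] Poly n :=
  ∑ i : Fin n, pderiv i p • LinearMap.proj i

theorem jacForm_apply (p : Poly n) (θ : Fin n → Poly n) :
    jacForm p θ = ∑ i, pderiv i p * θ i := by
  simp [jacForm]

theorem jacForm_mul (p q : Poly n) (θ : Fin n → Poly n) :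
    jacForm (p * q) θ = jacForm p θ * q + p * jacForm q θ := by
  simp only [jacForm_apply, pderiv_mul, Finset.sum_mul, Finset.mul_sum, ← Finset.sum_add_distrib]
  exact Finset.sum_congr rfl fun i _ => by ring

theorem jacForm_C_mul (a : ℂ) (q : Poly n) (θ : Fin n → Poly n) :
    jacForm (C a * q) θ = C a * jacForm q θ := by
  rw [jacForm_mul, jacForm_apply]
  simp

theorem jacForm_linearPoly (φ : Module.Dual ℂ (Fin n → ℂ)) (θ : Fin n → Poly n) :
    jacForm (linearPoly φ) θ = dotForm φ θ := by
  simp only [jacForm_apply, dotForm_apply, pderiv_linearPoly]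

theorem dotForm_X (φ : Module.Dual ℂ (Fin n → ℂ)) : dotForm φ X = linearPoly φ :=
  dotForm_apply φ X

theorem range_jacForm (f : Poly n) : LinearMap.range (jacForm f) = jacobianIdeal f := by
  rw [jacobianIdeal, Ideal.span, ← Fintype.range_linearCombination (Poly n)]
  congr 1
  refine LinearMap.ext fun θ => ?_
  simp [jacForm_apply, Fintype.linearCombination_apply, mul_comm]

theorem jacForm_graded {f : Poly n} {d : ℤ} (hf : f ∈ polyGrading n d) {c k : ℤ}
    {θ : Fin n → Poly n} (hθ : θ ∈ freeGrading (fun _ => c) k) :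
    jacForm f θ ∈ polyGrading n (k + (d - 1 - c)) := by
  rw [jacForm_apply]
  refine Submodule.sum_mem _ fun i _ => ?_
  have h : pderiv i f ∈ polyGrading n (d - 1) :=
    IsWeightedHomogeneous.pderiv (w := fun _ : Fin n => (1 : ℤ)) hf (by ring)
  have := polyGrading_mul h (mem_freeGrading.1 hθ i)
  rwa [show d - 1 + (k - c) = k + (d - 1 - c) by ring] at this

theorem polyProj_mem_jacobianIdeal {f : Poly n} {d : ℤ} (hf : f ∈ polyGrading n d) (k : ℤ)
    {p : Poly n} (hp : p ∈ jacobianIdeal f) : polyProj n k p ∈ jacobianIdeal f := by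
  rw [← range_jacForm] at hp ⊢
  obtain ⟨θ, rfl⟩ := hp
  have := (freeProj_gradedProj (fun _ : Fin n => (0 : ℤ))).map_proj (polyProj_gradedProj n)
    (jacForm f).toAddMonoidHom (fun k m hm => jacForm_graded hf hm) (k - (d - 1 - 0)) θ
  rw [sub_add_cancel] at this
  exact ⟨_, this⟩

theorem milnorGrading_isGradedModule {f : Poly n} {d : ℤ} (hf : f ∈ polyGrading n d) :
    IsGradedModule n (milnorGrading f) := by
  refine (polyGrading_isGradedModule n).map_of_surjective (polyProj_gradedProj n)
    (Ideal.Quotient.mkₐ ℂ (jacobianIdeal f)).toLinearMap Ideal.Quotient.mk_surjective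
    (fun _ _ => rfl) (fun k m hm => ?_)
  exact Ideal.Quotient.eq_zero_iff_mem.2
    (polyProj_mem_jacobianIdeal hf k (Ideal.Quotient.eq_zero_iff_mem.1 hm))

variable {ι : Type*} {φ : ι → Module.Dual ℂ (Fin n → ℂ)}

theorem prod_linearPoly_mem_polyGrading (s : Finset ι) :
    ∏ i ∈ s, linearPoly (φ i) ∈ polyGrading n s.card := by
  have := IsWeightedHomogeneous.prod (w := fun _ : Fin n => (1 : ℤ)) s
    (fun i => linearPoly (φ i)) (fun _ => 1) (fun i _ => linearPoly_mem_polyGrading (φ i))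
  simp only [Finset.sum_const, nsmul_eq_mul, mul_one] at this
  exact this

theorem prod_linearPoly_dvd_jacForm [DecidableEq ι] {s : Finset ι} {θ : Fin n → Poly n}
    (hθ : θ ∈ logDer φ s) :
    ∏ i ∈ s, linearPoly (φ i) ∣ jacForm (∏ i ∈ s, linearPoly (φ i)) θ := by
  induction s using Finset.induction_on with
  | empty => simp
  | insert i s hi ih =>
    rw [Finset.prod_insert hi, jacForm_mul, jacForm_linearPoly]
    exact dvd_add (mul_dvd_mul_right (hθ i (Finset.mem_insert_self i s)) _)
      (mul_dvd_mul_left _ (ih (logDer_mono (Finset.subset_insert i s) hθ)))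

/-- Euler's identity for a product of linear forms. -/
theorem jacForm_prod_linearPoly_X [DecidableEq ι] (s : Finset ι) :
    jacForm (∏ i ∈ s, linearPoly (φ i)) X = (s.card : Poly n) * ∏ i ∈ s, linearPoly (φ i) := by
  induction s using Finset.induction_on with
  | empty => simp [jacForm_apply]
  | insert i s hi ih =>
    rw [Finset.prod_insert hi, jacForm_mul, jacForm_linearPoly, dotForm_X, ih,
      Finset.card_insert_of_notMem hi]
    push_cast
    ring

/-- Reducedness enters here. With f = φ_i g, the Leibniz rule and θ(f) = 0 give φ_i ∣ φ_i(θ) g; the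
prime φ_i divides no other factor, hence it divides φ_i(θ). -/
theorem mem_logDer_of_jacForm_eq_zero [DecidableEq ι] {s : Finset ι} (hφ : ∀ i ∈ s, φ i ≠ 0)
    (hne : ∀ i ∈ s, ∀ k ∈ s, linearPoly (φ i) ∣ linearPoly (φ k) → i = k) {θ : Fin n → Poly n}
    (hθ : jacForm (∏ i ∈ s, linearPoly (φ i)) θ = 0) : θ ∈ logDer φ s := by
  intro i hi
  have hprime := prime_linearPoly (hφ i hi)
  rw [← Finset.mul_prod_erase s _ hi, jacForm_mul, jacForm_linearPoly] at hθ
  have hdvd : linearPoly (φ i) ∣ dotForm (φ i) θ * ∏ k ∈ s.erase i, linearPoly (φ k) := by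
    rw [eq_neg_of_add_eq_zero_left hθ]
    exact (dvd_mul_right _ _).neg_right
  refine (hprime.dvd_or_dvd hdvd).resolve_right fun h => ?_
  obtain ⟨k, hk, hik⟩ := (hprime.dvd_finsetProd_iff _).1 h
  have := hne i hi k (Finset.mem_of_mem_erase hk) hik
  exact Finset.ne_of_mem_erase hk this.symm

/-- Substituting along v with ψ(v) = 1 turns divisibility into proportionality χ = χ(v) ψ. -/
theorem ker_le_ker_of_dvd {ψ χ : Module.Dual ℂ (Fin n → ℂ)} (hψ : ψ ≠ 0)
    (h : linearPoly ψ ∣ linearPoly χ) : LinearMap.ker ψ ≤ LinearMap.ker χ := by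
  obtain ⟨v, hv⟩ := exists_apply_eq_one hψ
  have h0 := (linearPoly_dvd_iff hv _).1 h
  rw [substForm_linearPoly, sub_eq_zero] at h0
  have h1 : linearPolyHom n (χ - χ v • ψ) = 0 := by
    rw [map_sub, map_smul, smul_eq_C_mul, sub_eq_zero]
    exact h0
  have h2 : χ - χ v • ψ = 0 := by
    by_contra hne
    exact linearPoly_ne_zero hne h1
  intro x hx
  rw [sub_eq_zero.1 h2, LinearMap.mem_ker, LinearMap.smul_apply, LinearMap.mem_ker.1 hx,
    smul_zero]

end Jacobian

variable {n : ℕ}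

/-! ### Syzygies of the partial derivatives. -/

section Syzygies

theorem C_mul_prod_linearPoly_mem_polyGrading {ι : Type*}
    {φ : ι → Module.Dual ℂ (Fin n → ℂ)} (a : ℂ) (s : Finset ι) :
    C a * ∏ i ∈ s, linearPoly (φ i) ∈ polyGrading n s.card := by
  have := polyGrading_mul (C_mem_polyGrading a) (prod_linearPoly_mem_polyGrading (φ := φ) s)
  rwa [zero_add] at this

/-- The degree shift of the syzygies of the partial derivatives in the resolution of the shifted
Milnor algebra. -/
def syzGrading (f : Poly n) (e : ℤ) : ℤ → Submodule ℂ (LinearMap.ker (jacForm f)) :=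
  subGrading (freeGrading (n := n) (fun _ => e)) (LinearMap.ker (jacForm f))

theorem syzGrading_isGradedModule {f : Poly n} {d : ℤ} (hf : f ∈ polyGrading n d) (e : ℤ) :
    IsGradedModule n (syzGrading f e) :=
  subGrading_isGradedModule (freeGrading_isGradedModule _) (freeProj_gradedProj _) _
    fun k θ hθ => ker_stable (freeProj_gradedProj _) (polyProj_gradedProj n)
      (jacForm f).toAddMonoidHom (fun _ _ hm => jacForm_graded hf hm) k θ hθ

/-- The syzygies of the partial derivatives are a retract of the logarithmic derivations, by
subtracting multiples of the Euler derivation. -/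
theorem exists_syz_resolution {ι : Type*} [DecidableEq ι]
    {φ : ι → Module.Dual ℂ (Fin n → ℂ)} {s : Finset ι} (hs : s.Nonempty) (hφ : ∀ i ∈ s, φ i ≠ 0)
    (hne : ∀ i ∈ s, ∀ k ∈ s, linearPoly (φ i) ∣ linearPoly (φ k) → i = k) {a : ℂ} (ha : a ≠ 0)
    {b : ℤ} (hb : LogDerBound φ s b) (e : ℤ) :
    ∃ G : MinimalGradedFreeResolution (n := n)
        (syzGrading (C a * ∏ i ∈ s, linearPoly (φ i)) e), ∀ j k, G.c j k ≤ b + e + j := by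
  set f : Poly n := C a * ∏ i ∈ s, linearPoly (φ i) with hf
  have hCa : (C a : Poly n) ≠ 0 := by simpa using ha
  have hprod : ∏ i ∈ s, linearPoly (φ i) ≠ 0 :=
    Finset.prod_ne_zero_iff.2 fun i hi => linearPoly_ne_zero (hφ i hi)
  have hf0 : f ≠ 0 := mul_ne_zero hCa hprod
  have hfd : f ∈ polyGrading n s.card := C_mul_prod_linearPoly_mem_polyGrading a s
  have hle : LinearMap.ker (jacForm f) ≤ logDer φ s := fun θ hθ => by
    rw [LinearMap.mem_ker, hf, jacForm_C_mul] at hθ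
    exact mem_logDer_of_jacForm_eq_zero hφ hne ((mul_eq_zero.1 hθ).resolve_left hCa)
  obtain ⟨Q, hQ⟩ := exists_linear_quotient (jacForm f ∘ₗ (logDer φ s).subtype) hf0 (fun θ => by
    rw [hf, LinearMap.comp_apply, jacForm_C_mul]
    exact mul_dvd_mul_left _ (prod_linearPoly_dvd_jacForm θ.2))
  replace hQ : ∀ θ : logDer φ s, f * Q θ = jacForm f θ.1 := hQ
  have hcard : (s.card : ℂ) ≠ 0 := by
    simpa using hs.ne_empty
  have hEuler : jacForm f X = C (s.card : ℂ) * f := by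
    rw [hf, jacForm_C_mul, jacForm_prod_linearPoly_X, map_natCast]
    ring
  -- Euler's identity says that the Euler derivation multiplies f by its degree, so θ - (θ(f)/(deg f
  -- · f)) X kills f. The correction is zero when θ already kills f.
  let Ψ : logDer φ s →ₗ[Poly n] (Fin n → Poly n) :=
    (logDer φ s).subtype - ((C (s.card : ℂ)⁻¹ : Poly n) • Q).smulRight X
  have hΨ : ∀ θ, Ψ θ = θ.1 - (C (s.card : ℂ)⁻¹ * Q θ) • (X : Fin n → Poly n) := fun _ => rfl
  have hΨmem : ∀ θ, Ψ θ ∈ LinearMap.ker (jacForm f) := fun θ => by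
    rw [LinearMap.mem_ker, hΨ, map_sub, map_smul, hEuler, ← hQ, smul_eq_mul,
      show C (s.card : ℂ)⁻¹ * Q θ * (C (s.card : ℂ) * f) =
        (C (s.card : ℂ)⁻¹ * C (s.card : ℂ)) * (f * Q θ) by ring, ← C_mul, inv_mul_cancel₀ hcard,
      C_1, one_mul, sub_self]
  have : Module.Finite (Poly n) (LinearMap.ker (jacForm f)) :=
    Module.Finite.of_fg (IsNoetherian.noetherian _)
  have hgr := syzGrading_isGradedModule hfd e
  obtain ⟨F⟩ := nonempty_minimalGradedFreeResolution hgr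
  obtain ⟨G, hG⟩ := hb
  have hc : ∀ k (θ : Fin n → Poly n), θ ∈ freeGrading (fun _ => e) k ↔
      θ ∈ freeGrading (fun _ => 0) (-e + k) := fun k θ => by
    rw [← mem_freeGrading_add]
    simp only [zero_add]
  refine ⟨F, fun j k => ?_⟩
  obtain ⟨l, hl⟩ := F.exists_degree_le_of_retract (G.toGraded.shift e) hgr
    ((logDer_isGradedModule s).shift (-e)) (Submodule.inclusion hle)
    (fun k θ hθ => (hc k _).1 hθ) (LinearMap.codRestrict _ Ψ hΨmem)
    (fun k θ hθ => (hc k _).2 (by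
      change Ψ θ ∈ _
      rw [hΨ]
      refine sub_mem hθ ?_
      have hθ' : θ.1 ∈ freeGrading (fun _ => 0) (-e + k) := hθ
      have h1 : Q θ ∈ polyGrading n (-e + k - 1) := by
        refine mem_polyGrading_of_mul hf0 hfd ?_
        rw [hQ, show -e + k - 1 + (s.card : ℤ) = -e + k + ((s.card : ℤ) - 1 - 0) by ring]
        exact jacForm_graded hfd hθ'
      refine mem_freeGrading.2 fun i => ?_
      have h2 := polyGrading_mul (polyGrading_mul (C_mem_polyGrading (s.card : ℂ)⁻¹) h1)
        (X_mem_polyGrading i)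
      rwa [show 0 + (-e + k - 1) + 1 = -e + k - 0 by ring] at h2))
    (fun θ => Subtype.ext (by
      change Ψ (Submodule.inclusion hle θ) = θ.1
      have h0 : Q (Submodule.inclusion hle θ) = 0 := by
        apply mul_left_cancel₀ hf0
        rw [hQ, mul_zero]
        exact θ.2
      rw [hΨ, h0, mul_zero, zero_smul, sub_zero]
      rfl)) j k
  have := hG j l
  have hl' : F.c j k ≤ G.c j l + e := hl
  omega

end Syzygies

/-! ### The Milnor algebra and the final degree count. -/

section Milnor

/-- The covering of the shifted Milnor algebra by `R(-n)`. -/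
def milnorCover (f : Poly n) : (Fin 1 → Poly n) →ₗ[Poly n] MilnorAlgebra f :=
  (jacobianIdeal f).mkQ ∘ₗ LinearMap.proj 0

theorem mem_ker_milnorCover {f : Poly n} {v : Fin 1 → Poly n} :
    v ∈ LinearMap.ker (milnorCover f) ↔ v 0 ∈ jacobianIdeal f := by
  rw [LinearMap.mem_ker]
  exact Submodule.Quotient.mk_eq_zero _

/-- The covering of the Jacobian ideal by the partial derivatives. -/
def jacobianCover (f : Poly n) : (Fin n → Poly n) →ₗ[Poly n] LinearMap.ker (milnorCover f) :=
  LinearMap.codRestrict _ (LinearMap.pi fun _ => jacForm f) fun θ => by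
    rw [mem_ker_milnorCover, ← range_jacForm]
    exact ⟨θ, rfl⟩

theorem jacobianCover_apply (f : Poly n) (θ : Fin n → Poly n) :
    (jacobianCover f θ).1 0 = jacForm f θ := rfl

theorem ker_jacobianCover (f : Poly n) :
    LinearMap.ker (jacobianCover f) = LinearMap.ker (jacForm f) := by
  ext θ
  rw [LinearMap.mem_ker, LinearMap.mem_ker, ← jacobianCover_apply]
  constructor
  · intro h; rw [h]; rfl
  · intro h
    refine Subtype.ext (funext fun i => ?_)
    rw [Subsingleton.elim i 0, h]
    rfl

theorem jacobianCover_surjective (f : Poly n) : Function.Surjective (jacobianCover f) := by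
  rintro ⟨v, hv⟩
  rw [mem_ker_milnorCover, ← range_jacForm] at hv
  obtain ⟨θ, hθ⟩ := hv
  refine ⟨θ, Subtype.ext (funext fun i => ?_)⟩
  rw [Subsingleton.elim i 0]
  exact hθ

/-- A resolution of the shifted Milnor algebra from one of the syzygies of the partial
derivatives. -/
theorem exists_milnor_resolution {f : Poly n} {d : ℤ} (hf : f ∈ polyGrading n d) (a : ℤ)
    (G : GradedFreeResolution (n := n) (syzGrading f (a + (d - 1)))) {b : ℤ}
    (hG : ∀ j k, G.c j k ≤ b + j) (h0 : a + 2 ≤ b) (h1 : a + d ≤ b) :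
    ∃ H : GradedFreeResolution (n := n) (shift (milnorGrading f) (-a)),
      ∀ j k, H.c j k ≤ b - 2 + j := by
  obtain ⟨G', hG'⟩ : ∃ G' : GradedFreeResolution (n := n) (subGrading
      (freeGrading (n := n) (fun _ => a + (d - 1))) (LinearMap.ker (jacobianCover f))),
      ∀ j k, G'.c j k ≤ b + j := by
    rw [ker_jacobianCover]
    exact ⟨G, hG⟩
  let G₁ : GradedFreeResolution (n := n)
      (subGrading (freeGrading (n := n) (fun _ => a)) (LinearMap.ker (milnorCover f))) :=
    GradedFreeResolution.splice (fun k θ hθ => mem_subGrading.2 (mem_freeGrading.2 fun i => by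
      have := jacForm_graded hf hθ
      rw [show k + (d - 1 - (a + (d - 1))) = k - a by ring] at this
      rw [Subsingleton.elim i 0]
      exact this)) (jacobianCover_surjective f) G'
  let G₀ : GradedFreeResolution (n := n) (shift (milnorGrading f) (-a)) :=
    GradedFreeResolution.splice (c := fun _ => a) (p := milnorCover f) (fun k v hv => by
      refine ⟨v 0, ?_, rfl⟩
      have := mem_freeGrading.1 hv 0
      rwa [sub_eq_neg_add] at this) (fun x => by
      obtain ⟨p, rfl⟩ := Submodule.mkQ_surjective _ x
      exact ⟨fun _ => p, rfl⟩) G₁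
  -- The two new terms have degrees a and a + d - 1, which is what `h0` and `h1` control; the
  -- resolution of the syzygies moves up two positions, hence b - 2.
  refine ⟨G₀, fun j => ?_⟩
  match j with
  | 0 => intro k; change a ≤ _; push_cast; omega
  | 1 => intro k; change a + (d - 1) ≤ _; push_cast; omega
  | j + 2 =>
    intro k
    have : G₀.c (j + 2) k ≤ b + j := hG' j k
    push_cast
    omega

/-- The Milnor algebra of a linear form vanishes. -/
theorem subsingleton_milnorAlgebra {φ : Module.Dual ℂ (Fin n → ℂ)} (hφ : φ ≠ 0) {a : ℂ}
    (ha : a ≠ 0) : Subsingleton (MilnorAlgebra (C a * linearPoly φ)) := by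
  obtain ⟨i, hi⟩ : ∃ i, φ (Pi.single i 1) ≠ 0 := by
    by_contra! h
    apply hφ
    ext i
    simpa using h i
  rw [Ideal.Quotient.subsingleton_iff, Ideal.eq_top_iff_one]
  have h : pderiv i (C a * linearPoly φ) ∈ jacobianIdeal (C a * linearPoly φ) :=
    Ideal.subset_span ⟨i, rfl⟩
  rw [pderiv_C_mul, pderiv_linearPoly, ← C_mul] at h
  have := Ideal.mul_mem_left _ (C (a * φ (Pi.single i 1))⁻¹) h
  rwa [← C_mul, inv_mul_cancel₀ (mul_ne_zero ha hi), C_1] at this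

end Milnor

/-- If the forms spanned a proper subspace of the dual, a nonzero vector would lie in all the
hyperplanes. -/
theorem CentralArrangement.finrank_span_eq {D : CentralArrangement n} (hD : D.IsEssential)
    {φ : Submodule ℂ (Fin n → ℂ) → Module.Dual ℂ (Fin n → ℂ)}
    (hφ : ∀ H ∈ D.hyperplanes, LinearMap.ker (φ H) = H) :
    Module.finrank ℂ (Submodule.span ℂ (φ '' (D.hyperplanes : Set _))) = n := by
  have htop : Submodule.span ℂ (φ '' (D.hyperplanes : Set _)) = ⊤ := by
    by_contra hne
    obtain ⟨ψ, -, hψ⟩ := SetLike.exists_of_lt (lt_top_iff_ne_top.2 hne)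
    obtain ⟨v, hv, hv0⟩ := exists_vector_of_notMem_span hψ
    have : v ∈ ⨅ H ∈ D.hyperplanes, H := by
      simp only [Submodule.mem_iInf]
      intro H hH
      rw [← hφ H hH]
      exact hv0 _ ⟨H, hH, rfl⟩
    rw [hD, Submodule.mem_bot] at this
    rw [this, map_zero] at hv
    exact zero_ne_one hv
  rw [htop, finrank_top, Subspace.dual_finrank_eq, Module.finrank_fin_fun]

/-- Bounds on the degrees of a resolution bound the regularity. -/
theorem MinimalGradedFreeResolution.regularity_le {M : Type*} [AddCommGroup M] [Module ℂ M]
    [Module (Poly n) M] {ℳ : ℤ → Submodule ℂ M} (F : MinimalGradedFreeResolution (n := n) ℳ)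
    {b : ℤ} (h : ∀ j k, F.c j k ≤ b + j) : F.regularity ≤ ((b : ℝ) : EReal) := by
  refine iSup_le fun j => iSup_le fun k => ?_
  rw [EReal.coe_le_coe_iff, Int.cast_le]
  have := h j k
  omega

theorem CentralArrangement.milnor_degree_le {D : CentralArrangement n} (hn : 1 ≤ n) (hD : D.IsEssential)
    {f : Poly n} (hf : D.IsDefiningPolynomial f)
    (hgr : IsGradedModule n (shift (milnorGrading f) (-(n : ℤ))))
    (F : MinimalGradedFreeResolution (n := n) (shift (milnorGrading f) (-(n : ℤ))))
    (j : ℕ) (k : Fin (F.rank j)) : F.c j k ≤ 2 * (D.degree : ℤ) - 2 + j := by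
  classical
  obtain ⟨a, φ, ha, hker, rfl⟩ := hf
  have hφ : ∀ H ∈ D.hyperplanes, φ H ≠ 0 := fun H hH h0 => by
    apply (D.isCoatom H hH).1
    rw [← hker H hH, h0, LinearMap.ker_zero]
  have hrank := CentralArrangement.finrank_span_eq hD hker
  have hnd : n ≤ D.degree := by
    refine hrank.symm.trans_le ?_
    rw [← Finset.coe_image]
    exact (finrank_span_finset_le_card _).trans Finset.card_image_le
  -- For d = 1 the term R(-n) would already exceed the bound 0, but the Milnor algebra vanishes and
  -- so does its minimal resolution. Otherwise d ≥ 2 and d ≥ n give n + 2 ≤ 2d.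
  by_cases hd : D.degree = 1
  · obtain ⟨H, hH⟩ := Finset.card_eq_one.1 hd
    have hsub : Subsingleton (MilnorAlgebra (C a * ∏ H ∈ D.hyperplanes, linearPoly (φ H))) := by
      rw [hH, Finset.prod_singleton]
      exact subsingleton_milnorAlgebra (hφ H (by simp [hH])) ha
    obtain ⟨l, -⟩ := F.exists_degree_le_of_retract
      (GradedFreeResolution.ofFree (fun i : Fin 0 => i.elim0)) hgr (freeGrading_isGradedModule _)
      0 (fun _ _ _ => zero_mem _) 0 (fun _ _ _ => zero_mem _) (fun _ => Subsingleton.elim _ _) j k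
    cases j <;> exact l.elim0
  · have hne : ∀ H ∈ D.hyperplanes, ∀ H' ∈ D.hyperplanes,
        linearPoly (φ H) ∣ linearPoly (φ H') → H = H' := fun H hH H' hH' hdvd => by
      have := ker_le_ker_of_dvd (hφ H hH) hdvd
      rw [hker H hH, hker H' hH'] at this
      exact ((D.isCoatom H hH).le_iff_eq (D.isCoatom H' hH').1).1 this |>.symm
    have hb := logDerBound φ D.hyperplanes hφ
    rw [hrank] at hb
    have hs : D.hyperplanes.Nonempty := by
      rw [← Finset.card_pos]
      change 0 < D.degree
      omega
    -- The generators ∂f/∂x_i have degree n + d - 1 in the shifted grading, and (d - n + 1) + (n + d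
    -- - 1) = 2d.
    obtain ⟨G, hG⟩ := exists_syz_resolution hs hφ hne ha hb ((n : ℤ) + ((D.degree : ℤ) - 1))
    obtain ⟨G', hG'⟩ := exists_milnor_resolution (d := (D.degree : ℤ))
      (C_mul_prod_linearPoly_mem_polyGrading a D.hyperplanes) (n : ℤ) G.toGraded
      (b := 2 * (D.degree : ℤ)) (fun j k => (hG j k).trans (by
        rw [show D.hyperplanes.card = D.degree from rfl]
        omega)) (by omega) (by omega)
    obtain ⟨l, hl⟩ := F.exists_degree_le_of_retract G' hgr hgr LinearMap.id (fun _ _ h => h)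
      LinearMap.id (fun _ _ h => h) (fun _ => rfl) j k
    exact hl.trans (hG' j l)

end ArrangementRegularity

end

open ArrangementRegularity in
theorem corollary1p4 (n : ℕ) (hn : 1 ≤ n) (D : CentralArrangement n) (hD : D.IsEssential)
    (f : Poly n) (hf : D.IsDefiningPolynomial f) :
    Nonempty (MinimalGradedFreeResolution (n := n) (shift (milnorGrading f) (-(n : ℤ)))) ∧
      ∀ F : MinimalGradedFreeResolution (n := n) (shift (milnorGrading f) (-(n : ℤ))),
        F.regularity ≤ (((2 * (D.degree : ℤ) - 2 : ℤ) : ℝ) : EReal) := by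
  have hgr : IsGradedModule n (shift (milnorGrading f) (-(n : ℤ))) := by
    obtain ⟨a, φ, -, -, rfl⟩ := hf
    exact (milnorGrading_isGradedModule
      (C_mul_prod_linearPoly_mem_polyGrading a D.hyperplanes)).shift _
  exact ⟨nonempty_minimalGradedFreeResolution hgr, fun F =>
    F.regularity_le (CentralArrangement.milnor_degree_le hn hD hf hgr F)⟩
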